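/- Let $0<\lambda<1$ and let $X,Y$ be independent random vectors in $\mathbb{R}^n$ that have densities (with respect to Lebesgue measure) and zero mean. Put $$U=\sqrt{\lambda}\,X+\sqrt{1-\lambda}\,Y,\qquad V=-\sqrt{1-\lambda}\,X+\sqrt{\lambda}\,Y .$$ Let $h(Z)=-\int f_Z\log f_Z\in[-\infty,\infty)$ denote the differential entropy of a random vector $Z$ with density $f_Z$, let $h(U|V)=\int h(U|V=v)\,dP_V(v)$ denote the conditional differential entropy, where $h(U|V=v)$ is the differential entropy of the conditional law of $U$ given $V=v$, and let $I(U;V)=D(P_{U,V}\,\|\,P_U\otimes P_V)$ denote the mutual information. Then the reverse entropy-power inequality $$h(U|V)\le \lambda h(X)+(1-\lambda)h(Y)$$ holds. If moreover $h(X)$ and $h(Y)$ are finite, then $I(U;V)<\infty$, $h(U)=h(U|V)+I(U;V)$, and the deficit in the entropy-power inequality satisfies $$0\le h(U)-\lambda h(X)-(1-\lambda)h(Y)\le I(U;V);$$ and in this case each of the following holds if and only if $X$ and $Y$ are i.i.d. Gaussian: equality in the reverse entropy-power inequality; equality in the left-hand inequality for the deficit; equality in the right-hand inequality for the deficit; $I(U;V)=0$.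 -/

import Mathlib

open MeasureTheory ProbabilityTheory
open scoped ENNReal

noncomputable section

/-- The integral of an extended-real-valued function: the integral of the positive part minus the
integral of the negative part. It is the usual extended-valued integral whenever at least one of
the two parts has a finite integral. -/
def eintegral {α : Type*} [MeasurableSpace α] (μ : Measure α) (g : α → EReal) : EReal :=
  ((∫⁻ x, (g x).toENNReal ∂μ : ℝ≥0∞) : EReal) - ((∫⁻ x, (-g x).toENNReal ∂μ : ℝ≥0∞) : EReal)

open scoped Classical in
/-- Differential entropy `-∫ f log f` (in nats) of a law `μ` with density `f` with respect to the
Lebesgue measure; a law without a density has entropy `-∞`. -/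
def lawEntropy {E : Type*} [MeasureSpace E] (μ : Measure E) : EReal :=
  if μ ≪ volume then
    eintegral volume (fun x : E => ((Real.negMulLog (μ.rnDeriv volume x).toReal : ℝ) : EReal))
  else ⊥

/-- Differential entropy `h(X)` of a random vector `X`. -/
def diffEntropy {Ω E : Type*} [MeasurableSpace Ω] [MeasureSpace E]
    (X : Ω → E) (P : Measure Ω) : EReal :=
  lawEntropy (P.map X)

/-- Conditional differential entropy `h(U | V) = ∫ h(U | V = v) dP_V(v)`, where `h(U | V = v)` is
the differential entropy of the conditional law of `U` given `V = v`. -/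
def condDiffEntropy {Ω E F : Type*} [MeasurableSpace Ω] [MeasureSpace E] [StandardBorelSpace E]
    [Nonempty E] [MeasurableSpace F] (U : Ω → E) (V : Ω → F) (P : Measure Ω) [IsFiniteMeasure P] :
    EReal :=
  eintegral (P.map V) (fun v => lawEntropy (condDistrib U V P v))

/-- Mutual information `I(U; V)`: the Kullback-Leibler divergence of the joint law from the product
of the marginal laws. -/
def mutualInfo {Ω E F : Type*} [MeasurableSpace Ω] [MeasurableSpace E] [MeasurableSpace F]
    (U : Ω → E) (V : Ω → F) (P : Measure Ω) : ℝ≥0∞ :=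
  InformationTheory.klDiv (P.map (fun ω => (U ω, V ω))) ((P.map U).prod (P.map V))

/-- `X` and `Y` are Gaussian with the same law. -/
def IdentGaussian {Ω : Type*} [MeasurableSpace Ω] {n : ℕ}
    (X Y : Ω → EuclideanSpace ℝ (Fin n)) (P : Measure Ω) : Prop :=
  HasGaussianLaw X P ∧ HasGaussianLaw Y P ∧ IdentDistrib X Y P P

end

/-! Put a = √λ, b = √(1-λ). Everything rests on the entropy-power inequality in Lieb's form,
h(aX+bY) ≥ a²h(X) + b²h(Y), together with its equality case. The rotation (X,Y) ↦ (V,U) preserves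
volume, so h(U|V) = h(X) + h(Y) - h(V), and the inequality applied to V = -bX + aY gives the reverse
inequality for h(U|V). The mutual information is h(U) + h(V) - h(X) - h(Y), the sum of the two
nonnegative deficits of U and V, so all the equality cases reduce to those of U and V.

The inequality is proved by Gaussian transport. In dimension one write X = T(X*), Y = S(Y*) with X*,
Y* independent standard Gaussian and T, S increasing. After the rotation X* = au - bv, Y* = bu + av,
for fixed v the map u ↦ aT(au-bv) + bS(bu+av) is increasing with derivative a²T' + b²S' almost
everywhere. A change of variables, followed by T'^(a²) S'^(b²) ≤ a²T' + b²S', bounds the mean of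
q(aX+bY) e^w / (f(X)^(a²) g(Y)^(b²)) by ∫ q, where w = ab X*Y* is centred
(`lintegral_ratio_transport_le`). In higher dimension the maps are of Knothe type and the bound is
proved one coordinate at a time (`HasTransportBound.prod_real`). With q the density of aX+bY, the
inequality k ≤ e^k - 1 turns the bound into the entropy-power inequality (`entropy_power`).

In the case of equality T'(x) = S'(y) almost everywhere. If these derivatives are continuous they
are one common constant, so T and S are affine and the laws are Gaussian with equal variances.
Continuity is obtained without assumptions on the densities: an independent standard Gaussian
coordinate N is adjoined to each vector, at no cost in the inequality, and a shear makes N + ⟨v,X⟩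
the first coordinate, which has a continuous positive density. Hence each N + ⟨v,X⟩ is Gaussian,
then each ⟨v,X⟩ is, and the zero means make the two laws equal.

Finite first moments keep all entropies below +∞. When h(U|V) > -∞, the pointwise bound behind the
inequality shows that h(X) and h(Y) are finite (`integrable_llr_of_lintegral_cond`), so infinite
values cause no exception. -/

namespace EntropyPower

open Set Filter Topology

/-! ### Monotone transport on the real line -/

theorem integrable_of_withDensity_ofReal {f : ℝ → ℝ} (hf : Continuous f) (h0 : ∀ x, 0 ≤ f x)
    {μ : Measure ℝ} [IsFiniteMeasure μ]
    (hμ : μ = volume.withDensity fun x => ENNReal.ofReal (f x)) : Integrable f := by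
  refine ⟨hf.aestronglyMeasurable, ?_⟩
  rw [hasFiniteIntegral_iff_ofReal (ae_of_all _ h0)]
  have : μ univ = ∫⁻ x, ENNReal.ofReal (f x) := by
    rw [hμ, withDensity_apply _ MeasurableSet.univ, setLIntegral_univ]
  rw [← this]
  exact measure_lt_top _ _

theorem hasDerivAt_cdf_of_continuous {f : ℝ → ℝ} (hf : Continuous f) (h0 : ∀ x, 0 ≤ f x)
    {μ : Measure ℝ} [IsProbabilityMeasure μ]
    (hμ : μ = volume.withDensity fun x => ENNReal.ofReal (f x)) (x : ℝ) :
    HasDerivAt (cdf μ) (f x) x := by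
  have hint := integrable_of_withDensity_ofReal hf h0 hμ
  have hcdf : ∀ z, cdf μ z = (∫ y in Iic 0, f y) + ∫ y in (0 : ℝ)..z, f y := by
    intro z
    have h1 : ∀ z, cdf μ z = ∫ y in Iic z, f y := by
      intro z
      rw [cdf_eq_real, Measure.real, integral_eq_lintegral_of_nonneg_ae (ae_of_all _ h0)
        hf.aestronglyMeasurable]
      conv_lhs => rw [hμ, withDensity_apply _ measurableSet_Iic]
    rw [h1, ← intervalIntegral.integral_Iic_sub_Iic hint.integrableOn hint.integrableOn]
    ring
  have h2 : HasDerivAt (fun z => (∫ y in Iic 0, f y) + ∫ y in (0 : ℝ)..z, f y) (f x) x :=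
    (intervalIntegral.integral_hasDerivAt_right (hf.intervalIntegrable _ _)
      hf.stronglyMeasurable.stronglyMeasurableAtFilter hf.continuousAt).const_add _
  exact h2.congr_of_eventuallyEq (Eventually.of_forall hcdf)

/-- The standard Gaussian law on the line. -/
noncomputable abbrev stdGauss : Measure ℝ := gaussianReal 0 1

/-- The density of the standard Gaussian law. -/
noncomputable abbrev stdPDF : ℝ → ℝ := gaussianPDFReal 0 1

theorem stdPDF_pos (x : ℝ) : 0 < stdPDF x := gaussianPDFReal_pos _ _ _ one_ne_zero

theorem continuous_stdPDF : Continuous stdPDF := by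
  unfold stdPDF
  rw [gaussianPDFReal_def]
  fun_prop

theorem stdGauss_eq : stdGauss = volume.withDensity fun x => ENNReal.ofReal (stdPDF x) :=
  gaussianReal_of_var_ne_zero _ one_ne_zero

theorem hasDerivAt_cdf_stdGauss (x : ℝ) : HasDerivAt (cdf stdGauss) (stdPDF x) x :=
  hasDerivAt_cdf_of_continuous continuous_stdPDF (fun x => (stdPDF_pos x).le) stdGauss_eq x

theorem strictMono_of_hasDerivAt_pos {F f : ℝ → ℝ} (hF : ∀ x, HasDerivAt F (f x) x)
    (hf : ∀ x, 0 < f x) : StrictMono F :=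
  strictMono_of_deriv_pos fun x => by rw [(hF x).deriv]; exact hf x

theorem strictMono_cdf_stdGauss : StrictMono (cdf stdGauss) :=
  strictMono_of_hasDerivAt_pos hasDerivAt_cdf_stdGauss stdPDF_pos

theorem continuous_cdf_stdGauss : Continuous (cdf stdGauss) :=
  continuous_iff_continuousAt.2 fun x => (hasDerivAt_cdf_stdGauss x).continuousAt

theorem cdf_pos_of_strictMono {μ : Measure ℝ} (h : StrictMono (cdf μ)) (x : ℝ) : 0 < cdf μ x :=
  (cdf_nonneg μ (x - 1)).trans_lt (h (by linarith))

theorem cdf_lt_one_of_strictMono {μ : Measure ℝ} (h : StrictMono (cdf μ)) (x : ℝ) :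
    cdf μ x < 1 :=
  (h (show x < x + 1 by linarith)).trans_le (cdf_le_one μ (x + 1))

theorem exists_cdf_eq {μ : Measure ℝ} (h : Continuous (cdf μ)) {p : ℝ} (h0 : 0 < p) (h1 : p < 1) :
    ∃ x, cdf μ x = p := by
  obtain ⟨a, ha⟩ := ((tendsto_cdf_atBot μ).eventually_lt_const h0).exists
  obtain ⟨b, hb⟩ := ((tendsto_cdf_atTop μ).eventually_const_lt h1).exists
  exact mem_range_of_exists_le_of_exists_ge h ⟨a, ha.le⟩ ⟨b, hb.le⟩

/-- The monotone map transporting the standard Gaussian law to `μ`. -/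
noncomputable def transport (μ : Measure ℝ) (x : ℝ) : ℝ := sInf {z | cdf stdGauss x ≤ cdf μ z}

/-- Right continuity of the distribution function makes the infimum a minimum. This Galois
connection yields monotonicity, the image law and, later, joint measurability in a parameter. -/
theorem transport_le_iff (μ : Measure ℝ) (x z : ℝ) :
    transport μ x ≤ z ↔ cdf stdGauss x ≤ cdf μ z := by
  set S := {z | cdf stdGauss x ≤ cdf μ z} with hS
  have hne : S.Nonempty := by
    obtain ⟨b, hb⟩ := ((tendsto_cdf_atTop μ).eventually_const_lt
      (cdf_lt_one_of_strictMono strictMono_cdf_stdGauss x)).exists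
    exact ⟨b, hb.le⟩
  have hbdd : BddBelow S := by
    obtain ⟨a, ha⟩ := ((tendsto_cdf_atBot μ).eventually_lt_const
      (cdf_pos_of_strictMono strictMono_cdf_stdGauss x)).exists
    refine ⟨a, fun z hz => ?_⟩
    by_contra! h
    exact absurd (hz.trans (monotone_cdf μ h.le)) (not_le.2 ha)
  have hmem : sInf S ∈ S := by
    have hright : Tendsto (cdf μ) (𝓝[>] (sInf S)) (𝓝 (cdf μ (sInf S))) :=
      ((cdf μ).right_continuous (sInf S)).tendsto.mono_left (nhdsWithin_mono _ Ioi_subset_Ici_self)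
    refine ge_of_tendsto hright ?_
    filter_upwards [self_mem_nhdsWithin] with y hy
    obtain ⟨w, hw, hwy⟩ := exists_lt_of_csInf_lt hne hy
    exact le_trans hw (monotone_cdf μ hwy.le)
  exact ⟨fun h => le_trans hmem (monotone_cdf μ h), fun h => csInf_le hbdd h⟩

theorem monotone_transport (μ : Measure ℝ) : Monotone (transport μ) := fun x y hxy => by
  rw [transport_le_iff]
  exact (monotone_cdf _ hxy).trans ((transport_le_iff μ y _).1 le_rfl)

theorem measurable_transport (μ : Measure ℝ) : Measurable (transport μ) :=
  (monotone_transport μ).measurable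

theorem map_transport (μ : Measure ℝ) [IsProbabilityMeasure μ] :
    stdGauss.map (transport μ) = μ := by
  have := Measure.isProbabilityMeasure_map (μ := stdGauss) (measurable_transport μ).aemeasurable
  refine Measure.ext_of_Iic _ _ fun z => ?_
  rw [Measure.map_apply (measurable_transport μ) measurableSet_Iic]
  have h : transport μ ⁻¹' Iic z = {x | cdf stdGauss x ≤ cdf μ z} := by
    ext x; exact transport_le_iff μ x z
  rw [h, ← ofReal_cdf]
  -- The values 0 and 1 are never attained by the Gaussian distribution function, so they are
  -- treated apart.
  rcases (cdf_nonneg μ z).eq_or_lt with h0 | h0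
  · rw [← h0]
    simp [not_le.2 (cdf_pos_of_strictMono strictMono_cdf_stdGauss _)]
  rcases (cdf_le_one μ z).eq_or_lt with h1 | h1
  · rw [h1]
    simp [cdf_le_one]
  obtain ⟨w, hw⟩ := exists_cdf_eq continuous_cdf_stdGauss h0 h1
  rw [← hw, ofReal_cdf]
  congr 1
  ext x
  exact strictMono_cdf_stdGauss.le_iff_le

theorem continuous_cdf_of_ac {μ : Measure ℝ} [IsProbabilityMeasure μ] (h : μ ≪ volume) :
    Continuous (cdf μ) := by
  refine continuous_iff_continuousAt.2 fun x => ?_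
  have h1 : (cdf μ).measure {x} = 0 := by rw [measure_cdf]; exact h (measure_singleton x)
  rw [StieltjesFunction.measure_singleton, ENNReal.ofReal_eq_zero, sub_nonpos] at h1
  refine continuousAt_iff_continuous_left'_right'.2 ⟨?_, ?_⟩
  · rw [(monotone_cdf μ).continuousWithinAt_Iio_iff_leftLim_eq]
    exact le_antisymm ((monotone_cdf μ).leftLim_le le_rfl) h1
  · exact ((cdf μ).right_continuous x).mono Ioi_subset_Ici_self

theorem cdf_transport {μ : Measure ℝ} [IsProbabilityMeasure μ] (h : μ ≪ volume) (x : ℝ) :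
    cdf μ (transport μ x) = cdf stdGauss x := by
  refine le_antisymm ?_ ((transport_le_iff μ x _).1 le_rfl)
  have hleft : Tendsto (cdf μ) (𝓝[<] (transport μ x)) (𝓝 (cdf μ (transport μ x))) :=
    (continuous_cdf_of_ac h).continuousAt.tendsto.mono_left nhdsWithin_le_nhds
  refine le_of_tendsto hleft ?_
  filter_upwards [self_mem_nhdsWithin] with y hy
  by_contra! h
  exact absurd ((transport_le_iff μ x y).2 h.le) (not_le.2 hy)

theorem ae_comp_transport {μ : Measure ℝ} [IsProbabilityMeasure μ] {p : ℝ → Prop}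
    (h : ∀ᵐ x ∂μ, p x) : ∀ᵐ x ∂stdGauss, p (transport μ x) := by
  rw [← map_transport μ] at h
  exact ae_of_ae_map (measurable_transport μ).aemeasurable h

/-- Chain rule in F ∘ T = Φ, where F and Φ are the two distribution functions: F has the density as
derivative μ-almost everywhere, a property that T pulls back to Gaussian-almost every point, and T
is differentiable almost everywhere because it is monotone. -/
theorem ae_rnDeriv_transport_mul_deriv {μ : Measure ℝ} [IsProbabilityMeasure μ]
    (h : μ ≪ volume) : ∀ᵐ x ∂stdGauss, DifferentiableAt ℝ (transport μ) x ∧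
      (μ.rnDeriv volume (transport μ x)).toReal * deriv (transport μ) x = stdPDF x := by
  have h1 : ∀ᵐ z ∂μ, HasDerivAt (cdf μ) (μ.rnDeriv volume z).toReal z := by
    have := (cdf μ).ae_hasDerivAt
    rw [measure_cdf] at this
    exact h.ae_le this
  have h2 : ∀ᵐ x ∂stdGauss, DifferentiableAt ℝ (transport μ) x :=
    (gaussianReal_absolutelyContinuous 0 one_ne_zero).ae_le (monotone_transport μ).ae_differentiableAt
  filter_upwards [ae_comp_transport h1, h2] with x hx1 hx2
  refine ⟨hx2, ?_⟩
  have h3 := hx1.comp x hx2.hasDerivAt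
  have h4 : (cdf μ) ∘ transport μ = cdf stdGauss := funext (cdf_transport h)
  rw [h4] at h3
  exact h3.unique (hasDerivAt_cdf_stdGauss x)

/-- Only an inequality, since a monotone map may jump over part of the line; this direction is the
one required. -/
theorem lintegral_comp_mul_deriv_le {m : ℝ → ℝ} (hm : Monotone m) (q : ℝ → ℝ≥0∞) :
    ∫⁻ x, ENNReal.ofReal (deriv m x) * q (m x) ≤ ∫⁻ z, q z := by
  have hs : MeasurableSet {x | DifferentiableAt ℝ m x} := measurableSet_of_differentiableAt ℝ m
  have h1 : ∫⁻ x, ENNReal.ofReal (deriv m x) * q (m x) =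
      ∫⁻ x in {x | DifferentiableAt ℝ m x}, ENNReal.ofReal (deriv m x) * q (m x) := by
    have : (volume.restrict {x | DifferentiableAt ℝ m x}) = volume :=
      Measure.restrict_eq_self_of_ae_mem hm.ae_differentiableAt
    rw [this]
  rw [h1, ← lintegral_image_eq_lintegral_deriv_mul_of_monotoneOn hs
    (fun x hx => (DifferentiableAt.hasDerivAt hx).hasDerivWithinAt) (hm.monotoneOn _)]
  exact setLIntegral_le_lintegral _ _

/-! ### The one-dimensional transport inequality -/

theorem measurePreserving_rotate {a b : ℝ} (ha : 0 < a) (hab : a ^ 2 + b ^ 2 = 1) :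
    MeasurePreserving (fun p : ℝ × ℝ => (a * p.1 - b * p.2, b * p.1 + a * p.2))
      (stdGauss.prod stdGauss) (stdGauss.prod stdGauss) := by
  have hb1 : -1 ≤ -b := by nlinarith
  have hb2 : -b ≤ 1 := by nlinarith
  obtain ⟨θ, hc, hs⟩ : ∃ θ, Real.cos θ = a ∧ Real.sin θ = -b :=
    ⟨Real.arcsin (-b), by
      rw [Real.cos_arcsin, show 1 - (-b) ^ 2 = a ^ 2 by linarith, Real.sqrt_sq ha.le],
      Real.sin_arcsin hb1 hb2⟩
  have h := IsGaussian.map_rotation_eq_self (μ := stdGauss) (by simp) θ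
  refine ⟨by fun_prop, ?_⟩
  convert h using 2
  ext p
  · simp [ContinuousLinearMap.rotation_apply, hc, hs, sub_eq_add_neg]
  · simp [ContinuousLinearMap.rotation_apply, hc, hs]

theorem stdPDF_eq (x : ℝ) : stdPDF x = (√(2 * Real.pi))⁻¹ * Real.exp (-x ^ 2 / 2) := by
  simp [stdPDF, gaussianPDFReal_def]

/-- Rests on φ(x)^(a²) φ(y)^(b²) = e^(abxy) φ(ax+by) for the standard Gaussian density φ and a² + b²
= 1. This is the origin of the weight abxy. -/
theorem exp_mul_rpow_neg_mul_rpow_neg {a b : ℝ} (hab : a ^ 2 + b ^ 2 = 1) {x y F G D₁ D₂ : ℝ}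
    (hF : 0 < F) (hG : 0 < G) (h1 : F * D₁ = stdPDF x) (h2 : G * D₂ = stdPDF y) :
    Real.exp (a * b * (x * y)) * F ^ (-a ^ 2) * G ^ (-b ^ 2) =
      D₁ ^ (a ^ 2) * D₂ ^ (b ^ 2) / stdPDF (a * x + b * y) := by
  have hp1 : 0 < D₁ := by
    have := stdPDF_pos x; rw [← h1] at this; exact (pos_iff_pos_of_mul_pos this).1 hF
  have hp2 : 0 < D₂ := by
    have := stdPDF_pos y; rw [← h2] at this; exact (pos_iff_pos_of_mul_pos this).1 hG
  have hc : 0 < (√(2 * Real.pi))⁻¹ := by positivity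
  rw [← Real.exp_log (show 0 < Real.exp (a * b * (x * y)) * F ^ (-a ^ 2) * G ^ (-b ^ 2) by
    positivity), ← Real.exp_log (show 0 < D₁ ^ (a ^ 2) * D₂ ^ (b ^ 2) / stdPDF (a * x + b * y) from
    div_pos (by positivity) (stdPDF_pos _))]
  congr 1
  have e1 : Real.log F + Real.log D₁ = Real.log (√(2 * Real.pi))⁻¹ - x ^ 2 / 2 := by
    rw [← Real.log_mul hF.ne' hp1.ne', h1, stdPDF_eq, Real.log_mul hc.ne' (Real.exp_pos _).ne',
      Real.log_exp]; ring
  have e2 : Real.log G + Real.log D₂ = Real.log (√(2 * Real.pi))⁻¹ - y ^ 2 / 2 := by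
    rw [← Real.log_mul hG.ne' hp2.ne', h2, stdPDF_eq, Real.log_mul hc.ne' (Real.exp_pos _).ne',
      Real.log_exp]; ring
  rw [Real.log_mul (by positivity) (by positivity), Real.log_mul (by positivity) (by positivity),
    Real.log_div (by positivity) (stdPDF_pos _).ne', Real.log_mul (by positivity) (by positivity),
    Real.log_exp, Real.log_rpow hF, Real.log_rpow hG, Real.log_rpow hp1, Real.log_rpow hp2,
    stdPDF_eq, Real.log_mul hc.ne' (Real.exp_pos _).ne', Real.log_exp]
  linear_combination (-a ^ 2) * e1 - b ^ 2 * e2 +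
    (- Real.log (√(2 * Real.pi))⁻¹) * hab

/-- The quotient `q(ax+by) eʷ / (f(x)^(a²) g(y)^(b²))`. -/
noncomputable def ratio {E : Type*} [AddCommGroup E] [Module ℝ E] (a b : ℝ) (q f g : E → ℝ≥0∞)
    (w : ℝ) (x y : E) : ℝ≥0∞ :=
  q (a • x + b • y) * ENNReal.ofReal (Real.exp w) * f x ^ (-a ^ 2) * g y ^ (-b ^ 2)

theorem mul_toReal_pos {F : ℝ≥0∞} {D c : ℝ} (hc : 0 < c) (h : F.toReal * D = c) :
    0 < F.toReal := by
  refine lt_of_le_of_ne ENNReal.toReal_nonneg fun h0 => ?_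
  rw [← h0, zero_mul] at h
  exact hc.ne h

theorem ratio_eq_of_mul_eq {a b : ℝ} (hab : a ^ 2 + b ^ 2 = 1) (q f g : ℝ → ℝ≥0∞)
    {x y X Y D₁ D₂ : ℝ} (h1 : (f X).toReal * D₁ = stdPDF x) (h2 : (g Y).toReal * D₂ = stdPDF y) :
    ratio a b q f g (a * b * (x * y)) X Y = q (a * X + b * Y) *
      ENNReal.ofReal (D₁ ^ (a ^ 2) * D₂ ^ (b ^ 2) / stdPDF (a * x + b * y)) := by
  have hF := mul_toReal_pos (stdPDF_pos x) h1
  have hG := mul_toReal_pos (stdPDF_pos y) h2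
  have e1 : f X = ENNReal.ofReal (f X).toReal :=
    (ENNReal.ofReal_toReal (ENNReal.toReal_pos_iff.1 hF).2.ne).symm
  have e2 : g Y = ENNReal.ofReal (g Y).toReal :=
    (ENNReal.ofReal_toReal (ENNReal.toReal_pos_iff.1 hG).2.ne).symm
  rw [← exp_mul_rpow_neg_mul_rpow_neg hab hF hG h1 h2, ratio, e1, e2,
    ENNReal.ofReal_rpow_of_pos hF, ENNReal.ofReal_rpow_of_pos hG, mul_assoc, mul_assoc,
    ← ENNReal.ofReal_mul (by positivity), ← ENNReal.ofReal_mul (by positivity), ← mul_assoc,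
    ENNReal.toReal_ofReal hF.le, ENNReal.toReal_ofReal hG.le]
  simp

/-- The integrand dominating `ratio` after transport to Gaussian variables. -/
noncomputable def jacobianRatio (a b : ℝ) (q : ℝ → ℝ≥0∞) (T S : ℝ → ℝ) (p : ℝ × ℝ) : ℝ≥0∞ :=
  q (a * T p.1 + b * S p.2) *
    ENNReal.ofReal ((a ^ 2 * deriv T p.1 + b ^ 2 * deriv S p.2) / stdPDF (a * p.1 + b * p.2))

theorem measurable_jacobianRatio (a b : ℝ) {q : ℝ → ℝ≥0∞} (hq : Measurable q) {T S : ℝ → ℝ}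
    (hT : Measurable T) (hS : Measurable S) : Measurable (jacobianRatio a b q T S) := by
  have h1 := measurable_deriv T
  have h2 := measurable_deriv S
  have h3 := continuous_stdPDF.measurable
  unfold jacobianRatio
  fun_prop

/-- In the rotated coordinates (u, v) the denominator is φ(u) and cancels the Gaussian weight in u.
For each fixed v there remains the integral of m' · (q ∘ m) with m increasing. -/
theorem lintegral_jacobianRatio_le {a b : ℝ} (ha : 0 < a) (hb : 0 < b) (hab : a ^ 2 + b ^ 2 = 1)
    {q : ℝ → ℝ≥0∞} (hq : Measurable q) {T S : ℝ → ℝ} (hT : Monotone T) (hS : Monotone S) :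
    ∫⁻ p, jacobianRatio a b q T S p ∂(stdGauss.prod stdGauss) ≤ ∫⁻ z, q z := by
  have hmeas := measurable_jacobianRatio a b hq hT.measurable hS.measurable
  rw [← (measurePreserving_rotate ha hab).lintegral_comp hmeas, lintegral_prod_symm
    (fun p : ℝ × ℝ => jacobianRatio a b q T S (a * p.1 - b * p.2, b * p.1 + a * p.2))
    (hmeas.comp (measurePreserving_rotate ha hab).measurable).aemeasurable]
  have key : ∀ v, ∫⁻ u, jacobianRatio a b q T S (a * u - b * v, b * u + a * v) ∂stdGauss ≤
      ∫⁻ z, q z := by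
    intro v
    set m : ℝ → ℝ := fun u => a * T (a * u - b * v) + b * S (b * u + a * v) with hm
    have hmono : Monotone m := fun u u' h => by
      have h1 : T (a * u - b * v) ≤ T (a * u' - b * v) := hT (by nlinarith)
      have h2 : S (b * u + a * v) ≤ S (b * u' + a * v) := hS (by nlinarith)
      simp only [hm]
      nlinarith
    -- Nondegenerate affine maps pull null sets back to null sets, so almost everywhere
    -- differentiability survives on each line v = const.
    have haff : ∀ {c d : ℝ}, 0 < c → ∀ {R : ℝ → ℝ}, Monotone R →
        ∀ᵐ u, DifferentiableAt ℝ R (c * u + d) := by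
      intro c d hc R hR
      have hq : Measure.QuasiMeasurePreserving (fun u : ℝ => c * u + d) volume volume := by
        have h1 : Measure.QuasiMeasurePreserving (fun u : ℝ => c * u) volume volume := by
          refine ⟨by fun_prop, ?_⟩
          have := Real.map_volume_mul_left hc.ne'
          rw [this]
          exact Measure.smul_absolutelyContinuous
        exact (measurePreserving_add_right volume d).quasiMeasurePreserving.comp h1
      exact hq.ae hR.ae_differentiableAt
    have hae : ∀ᵐ u, jacobianRatio a b q T S (a * u - b * v, b * u + a * v) *
        ENNReal.ofReal (stdPDF u) = ENNReal.ofReal (deriv m u) * q (m u) := by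
      filter_upwards [haff (d := -(b * v)) ha hT, haff (d := a * v) hb hS] with u h1 h2
      have hd : HasDerivAt m (a ^ 2 * deriv T (a * u - b * v) + b ^ 2 * deriv S (b * u + a * v))
          u := by
        rw [← sub_eq_add_neg] at h1
        have e1 : HasDerivAt (fun u => T (a * u - b * v)) (deriv T (a * u - b * v) * a) u :=
          h1.hasDerivAt.comp u (by simpa using ((hasDerivAt_id u).const_mul a).sub_const (b * v))
        have e2 : HasDerivAt (fun u => S (b * u + a * v)) (deriv S (b * u + a * v) * b) u :=
          h2.hasDerivAt.comp u (by simpa using ((hasDerivAt_id u).const_mul b).add_const (a * v))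
        exact ((e1.const_mul a).add (e2.const_mul b)).congr_deriv (by ring)
      have hu : a * (a * u - b * v) + b * (b * u + a * v) = u := by
        linear_combination u * hab
      rw [hd.deriv, jacobianRatio]
      simp only [hu]
      rw [mul_assoc, ← ENNReal.ofReal_mul' (stdPDF_pos u).le, div_mul_cancel₀ _ (stdPDF_pos u).ne',
        mul_comm]
    have hm2 : Measurable fun u => jacobianRatio a b q T S (a * u - b * v, b * u + a * v) :=
      hmeas.comp (by fun_prop)
    have hm3 : Measurable fun u => ENNReal.ofReal (stdPDF u) :=
      continuous_stdPDF.measurable.ennreal_ofReal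
    rw [stdGauss_eq, lintegral_withDensity_eq_lintegral_mul _ hm3 hm2]
    calc _ = ∫⁻ u, ENNReal.ofReal (deriv m u) * q (m u) :=
          lintegral_congr_ae (hae.mono fun u hu => by
            simp only [Pi.mul_apply]; rw [mul_comm, hu])
      _ ≤ _ := lintegral_comp_mul_deriv_le hmono q
  calc _ ≤ ∫⁻ _ : ℝ, (∫⁻ z, q z) ∂stdGauss := lintegral_mono fun v => key v
    _ = _ := by simp

theorem ae_ratio_eq {a b : ℝ} (hab : a ^ 2 + b ^ 2 = 1)
    (q : ℝ → ℝ≥0∞) {f g : ℝ → ℝ≥0∞} (hf : Measurable f) (hg : Measurable g)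
    {μ ν : Measure ℝ} [IsProbabilityMeasure μ] [IsProbabilityMeasure ν]
    (hμ : μ = volume.withDensity f) (hν : ν = volume.withDensity g) :
    ∀ᵐ p ∂(stdGauss.prod stdGauss),
      (0 < deriv (transport μ) p.1 ∧ 0 < deriv (transport ν) p.2) ∧
      ratio a b q f g (a * b * (p.1 * p.2)) (transport μ p.1) (transport ν p.2) =
      q (a * transport μ p.1 + b * transport ν p.2) *
        ENNReal.ofReal (deriv (transport μ) p.1 ^ (a ^ 2) * deriv (transport ν) p.2 ^ (b ^ 2) /
          stdPDF (a * p.1 + b * p.2)) := by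
  have key : ∀ {f : ℝ → ℝ≥0∞}, Measurable f → ∀ {μ : Measure ℝ} [IsProbabilityMeasure μ],
      μ = volume.withDensity f → ∀ᵐ x ∂stdGauss,
        0 < deriv (transport μ) x ∧ (f (transport μ x)).toReal * deriv (transport μ) x = stdPDF x := by
    intro f hf μ _ hμ
    have hac : μ ≪ volume := hμ ▸ withDensity_absolutelyContinuous _ _
    have h1 : ∀ᵐ z ∂μ, μ.rnDeriv volume z = f z := by
      refine hac.ae_le ?_
      have := Measure.rnDeriv_withDensity volume hf
      rw [← hμ] at this
      exact this
    filter_upwards [ae_comp_transport h1, ae_rnDeriv_transport_mul_deriv hac] with x hx1 hx2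
    rw [hx1] at hx2
    refine ⟨?_, hx2.2⟩
    have := stdPDF_pos x
    rw [← hx2.2] at this
    exact (pos_iff_pos_of_mul_pos this).1 (mul_toReal_pos (stdPDF_pos x) hx2.2)
  have h1 := Measure.quasiMeasurePreserving_fst (μ := stdGauss) (ν := stdGauss) |>.ae (key hf hμ)
  have h2 := Measure.quasiMeasurePreserving_snd (μ := stdGauss) (ν := stdGauss) |>.ae (key hg hν)
  filter_upwards [h1, h2] with p hp1 hp2
  exact ⟨⟨hp1.1, hp2.1⟩, ratio_eq_of_mul_eq hab q f g hp1.2 hp2.2⟩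

theorem ratio_le_jacobianRatio {a b : ℝ} (hab : a ^ 2 + b ^ 2 = 1) {D₁ D₂ : ℝ} (h1 : 0 < D₁)
    (h2 : 0 < D₂) : D₁ ^ (a ^ 2) * D₂ ^ (b ^ 2) ≤ a ^ 2 * D₁ + b ^ 2 * D₂ :=
  Real.geom_mean_le_arith_mean2_weighted (sq_nonneg a) (sq_nonneg b) h1.le h2.le hab

theorem eq_of_geom_mean_eq_arith_mean {a b : ℝ} (ha : 0 < a) (hb : 0 < b)
    (hab : a ^ 2 + b ^ 2 = 1) {D₁ D₂ : ℝ} (h1 : 0 < D₁)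
    (h2 : 0 < D₂) (h : D₁ ^ (a ^ 2) * D₂ ^ (b ^ 2) = a ^ 2 * D₁ + b ^ 2 * D₂) : D₁ = D₂ := by
  by_contra hne
  have h3 := strictConcaveOn_log_Ioi.2 h1 h2 hne (pow_pos ha 2) (pow_pos hb 2) hab
  simp only [smul_eq_mul] at h3
  rw [← h, Real.log_mul (by positivity) (by positivity), Real.log_rpow h1, Real.log_rpow h2] at h3
  exact lt_irrefl _ h3

theorem ae_ratio_le_jacobianRatio {a b : ℝ} (hab : a ^ 2 + b ^ 2 = 1)
    (q : ℝ → ℝ≥0∞) {f g : ℝ → ℝ≥0∞} (hf : Measurable f) (hg : Measurable g)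
    {μ ν : Measure ℝ} [IsProbabilityMeasure μ] [IsProbabilityMeasure ν]
    (hμ : μ = volume.withDensity f) (hν : ν = volume.withDensity g) :
    ∀ᵐ p ∂(stdGauss.prod stdGauss),
      ratio a b q f g (a * b * (p.1 * p.2)) (transport μ p.1) (transport ν p.2) ≤
        jacobianRatio a b q (transport μ) (transport ν) p := by
  filter_upwards [ae_ratio_eq hab q hf hg hμ hν] with p hp
  rw [hp.2, jacobianRatio]
  gcongr
  · exact (stdPDF_pos _).le
  · exact ratio_le_jacobianRatio hab hp.1.1 hp.1.2

theorem lintegral_ratio_transport_le {a b : ℝ} (ha : 0 < a) (hb : 0 < b)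
    (hab : a ^ 2 + b ^ 2 = 1)
    {q f g : ℝ → ℝ≥0∞} (hq : Measurable q) (hf : Measurable f) (hg : Measurable g)
    {μ ν : Measure ℝ} [IsProbabilityMeasure μ] [IsProbabilityMeasure ν]
    (hμ : μ = volume.withDensity f) (hν : ν = volume.withDensity g) :
    ∫⁻ p, ratio a b q f g (a * b * (p.1 * p.2)) (transport μ p.1) (transport ν p.2)
      ∂(stdGauss.prod stdGauss) ≤ ∫⁻ z, q z :=
  (lintegral_mono_ae (ae_ratio_le_jacobianRatio hab q hf hg hμ hν)).trans
    (lintegral_jacobianRatio_le ha hb hab hq (monotone_transport μ) (monotone_transport ν))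

/-- An `ℝ≥0∞`-valued function at least `1` with integral at most `1` equals `1`. -/
theorem ae_eq_one_of_one_le {α : Type*} [MeasurableSpace α] {ρ : Measure α}
    [IsProbabilityMeasure ρ] {h : α → ℝ≥0∞} (hm : AEMeasurable h ρ) (h1 : ∀ᵐ x ∂ρ, 1 ≤ h x)
    (h2 : ∫⁻ x, h x ∂ρ ≤ 1) : ∀ᵐ x ∂ρ, h x = 1 := by
  have := ae_eq_of_ae_le_of_lintegral_le (f := fun _ => 1) h1 (by simp) hm (by simpa using h2)
  exact this.mono fun x hx => hx.symm

/-- `ratio` = 1 lies below `jacobianRatio`, whose integral is at most 1, so both equal 1 almost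
everywhere. The common factor q is then neither 0 nor ∞ and cancels, which leaves equality between
the geometric and arithmetic means of the two derivatives. -/
theorem ae_deriv_transport_eq {a b : ℝ} (ha : 0 < a) (hb : 0 < b)
    (hab : a ^ 2 + b ^ 2 = 1)
    {q f g : ℝ → ℝ≥0∞} (hq : Measurable q) (hf : Measurable f) (hg : Measurable g)
    {μ ν : Measure ℝ} [IsProbabilityMeasure μ] [IsProbabilityMeasure ν]
    (hμ : μ = volume.withDensity f) (hν : ν = volume.withDensity g) (hq1 : ∫⁻ z, q z ≤ 1)
    (h : ∀ᵐ p ∂(stdGauss.prod stdGauss),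
      ratio a b q f g (a * b * (p.1 * p.2)) (transport μ p.1) (transport ν p.2) = 1) :
    ∀ᵐ p ∂(stdGauss.prod stdGauss), deriv (transport μ) p.1 = deriv (transport ν) p.2 := by
  have hmeas := measurable_jacobianRatio a b hq (measurable_transport μ) (measurable_transport ν)
  have h1 : ∀ᵐ p ∂(stdGauss.prod stdGauss),
      jacobianRatio a b q (transport μ) (transport ν) p = 1 := by
    refine ae_eq_one_of_one_le hmeas.aemeasurable ?_ ((lintegral_jacobianRatio_le ha hb hab hq
      (monotone_transport μ) (monotone_transport ν)).trans hq1)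
    filter_upwards [h, ae_ratio_le_jacobianRatio hab q hf hg hμ hν] with p hp1 hp2
    rwa [hp1] at hp2
  filter_upwards [h, h1, ae_ratio_eq hab q hf hg hμ hν] with p hp1 hp2 hp3
  obtain ⟨⟨hd1, hd2⟩, hp3⟩ := hp3
  rw [hp1] at hp3
  rw [jacobianRatio, hp3] at hp2
  have hpos := stdPDF_pos (a * p.1 + b * p.2)
  have hq0 : q (a * transport μ p.1 + b * transport ν p.2) ≠ 0 := fun h0 => by
    simp [h0] at hp3
  have hqt : q (a * transport μ p.1 + b * transport ν p.2) ≠ ∞ := fun h0 => by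
    rw [h0, ENNReal.top_mul (by simpa using by positivity)] at hp3
    exact absurd hp3 (by simp)
  rw [ENNReal.mul_right_inj hq0 hqt, ENNReal.ofReal_eq_ofReal_iff (by positivity) (by positivity),
    div_left_inj' hpos.ne'] at hp2
  exact eq_of_geom_mean_eq_arith_mean ha hb hab hd1 hd2 hp2.symm

/-! ### Equality in dimension one for regular densities -/

/-- A law on the line with a continuous positive density. -/
def HasRegularDensity (μ : Measure ℝ) : Prop :=
  ∃ f : ℝ → ℝ, Continuous f ∧ (∀ x, 0 < f x) ∧ μ = volume.withDensity fun x => ENNReal.ofReal (f x)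

theorem continuous_transport {f : ℝ → ℝ} (hf : Continuous f) (h0 : ∀ x, 0 < f x)
    {μ : Measure ℝ} [IsProbabilityMeasure μ]
    (hμ : μ = volume.withDensity fun x => ENNReal.ofReal (f x)) : Continuous (transport μ) := by
  have hd := hasDerivAt_cdf_of_continuous hf (fun x => (h0 x).le) hμ
  have hs : StrictMono (cdf μ) := strictMono_of_hasDerivAt_pos hd h0
  refine (monotone_transport μ).continuous_of_surjective fun z => ?_
  obtain ⟨x, hx⟩ := exists_cdf_eq continuous_cdf_stdGauss (cdf_pos_of_strictMono hs z)
    (cdf_lt_one_of_strictMono hs z)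
  refine ⟨x, hs.injective ?_⟩
  rw [cdf_transport (hμ ▸ withDensity_absolutelyContinuous _ _), hx]

/-- The slope of the transport map between x and y is the slope of Φ there divided by the slope of
the target distribution function between the image points. Regularity of the density gives the
derivative at every point and not merely almost everywhere. -/
theorem hasDerivAt_transport {f : ℝ → ℝ} (hf : Continuous f) (h0 : ∀ x, 0 < f x)
    {μ : Measure ℝ} [IsProbabilityMeasure μ]
    (hμ : μ = volume.withDensity fun x => ENNReal.ofReal (f x)) (x : ℝ) :
    HasDerivAt (transport μ) (stdPDF x / f (transport μ x)) x := by
  have hd := hasDerivAt_cdf_of_continuous hf (fun x => (h0 x).le) hμ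
  have hT : ∀ x, cdf μ (transport μ x) = cdf stdGauss x :=
    cdf_transport (hμ ▸ withDensity_absolutelyContinuous _ _)
  have hinj : Function.Injective (transport μ) := fun x y hxy =>
    strictMono_cdf_stdGauss.injective (by rw [← hT, ← hT, hxy])
  have h1 := hasDerivAt_iff_tendsto_slope.1 (hasDerivAt_cdf_stdGauss x)
  have h2 := hasDerivAt_iff_tendsto_slope.1 (hd (transport μ x))
  have h3 : Tendsto (transport μ) (𝓝[≠] x) (𝓝[≠] (transport μ x)) :=
    tendsto_nhdsWithin_of_tendsto_nhds_of_eventually_within _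
      ((continuous_transport hf h0 hμ).continuousAt.tendsto.mono_left nhdsWithin_le_nhds)
      (eventually_mem_nhdsWithin.mono fun y hy h => hy (hinj h))
  rw [hasDerivAt_iff_tendsto_slope]
  refine (h1.div (h2.comp h3) (h0 _).ne').congr' ?_
  filter_upwards [self_mem_nhdsWithin] with y hy
  have hne : transport μ y - transport μ x ≠ 0 := sub_ne_zero.2 fun h => hy (hinj h)
  have hne' : cdf stdGauss y - cdf stdGauss x ≠ 0 :=
    sub_ne_zero.2 fun h => hy (strictMono_cdf_stdGauss.injective h)
  have hne2 : y - x ≠ 0 := sub_ne_zero.2 hy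
  simp only [Pi.div_apply, Function.comp, slope_def_field, hT]
  field_simp

theorem continuous_deriv_transport {μ : Measure ℝ} [IsProbabilityMeasure μ]
    (h : HasRegularDensity μ) : Differentiable ℝ (transport μ) ∧
      (∀ x, 0 < deriv (transport μ) x) ∧ Continuous (deriv (transport μ)) := by
  obtain ⟨f, hf, h0, hμ⟩ := h
  have h1 := hasDerivAt_transport hf h0 hμ
  have h2 : deriv (transport μ) = fun x => stdPDF x / f (transport μ x) :=
    funext fun x => (h1 x).deriv
  refine ⟨fun x => (h1 x).differentiableAt, fun x => ?_, ?_⟩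
  · rw [h2]; exact div_pos (stdPDF_pos x) (h0 _)
  · rw [h2]
    exact continuous_stdPDF.div (hf.comp (continuous_transport hf h0 hμ)) fun x => (h0 _).ne'

theorem eq_gaussianReal_of_deriv_transport {μ : Measure ℝ} [IsProbabilityMeasure μ]
    (hd : Differentiable ℝ (transport μ)) {c : ℝ} (hc : ∀ x, deriv (transport μ) x = c) :
    μ = gaussianReal (transport μ 0) ⟨c ^ 2, sq_nonneg c⟩ := by
  have h1 : ∀ x, transport μ x = c * x + transport μ 0 := by
    have h2 : ∀ x, HasDerivAt (fun x => transport μ x - c * x) 0 x := fun x =>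
      ((hd x).hasDerivAt.sub ((hasDerivAt_id x).const_mul c)).congr_deriv (by rw [hc]; simp)
    intro x
    have := is_const_of_deriv_eq_zero (fun x => (h2 x).differentiableAt) (fun x => (h2 x).deriv) x 0
    simp only [mul_zero, sub_zero] at this
    linarith
  have h3 : stdGauss.map (transport μ) = gaussianReal (transport μ 0) ⟨c ^ 2, sq_nonneg c⟩ := by
    have h4 : transport μ = (fun x => x + transport μ 0) ∘ fun x => c * x := funext h1
    rw [h4, ← Measure.map_map (by fun_prop) (by fun_prop), gaussianReal_map_const_mul,
      gaussianReal_map_add_const, mul_zero, zero_add, mul_one, ← h4]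
    rfl
  rw [← h3, map_transport]

/-- Rigidity of a pair of laws on the line: if both have regular densities, then both are Gaussian
with the same variance. -/
def GaussianRigid (μ ν : Measure ℝ) : Prop :=
  HasRegularDensity μ → HasRegularDensity ν →
    ∃ m₁ m₂ v, μ = gaussianReal m₁ v ∧ ν = gaussianReal m₂ v

/-- An almost everywhere identity between a continuous function of x and a continuous function of y
holds everywhere, so both are the same constant and both transport maps are affine with the same
slope. -/
theorem gaussianRigid_of_ae_deriv_eq {μ ν : Measure ℝ} [IsProbabilityMeasure μ]
    [IsProbabilityMeasure ν] (h : ∀ᵐ p ∂(stdGauss.prod stdGauss),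
      deriv (transport μ) p.1 = deriv (transport ν) p.2) : GaussianRigid μ ν := by
  intro hμ hν
  obtain ⟨hd1, hp1, hc1⟩ := continuous_deriv_transport hμ
  obtain ⟨hd2, hp2, hc2⟩ := continuous_deriv_transport hν
  have hac : (volume : Measure (ℝ × ℝ)) ≪ stdGauss.prod stdGauss := by
    rw [Measure.volume_eq_prod]
    exact (gaussianReal_absolutelyContinuous' 0 one_ne_zero).prod
      (gaussianReal_absolutelyContinuous' 0 one_ne_zero)
  have h1 : (fun p : ℝ × ℝ => deriv (transport μ) p.1) = fun p => deriv (transport ν) p.2 :=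
    (Continuous.ae_eq_iff_eq (volume : Measure (ℝ × ℝ)) (hc1.comp continuous_fst)
      (hc2.comp continuous_snd)).1 (hac.ae_le h)
  have h2 : ∀ x y, deriv (transport μ) x = deriv (transport ν) y := fun x y => congrFun h1 (x, y)
  refine ⟨_, _, _, eq_gaussianReal_of_deriv_transport hd1 (fun x => h2 x 0),
    eq_gaussianReal_of_deriv_transport hd2 (c := deriv (transport ν) 0) fun x => ?_⟩
  rw [← h2 0 x, ← h2 0 0]

/-! ### The transport inequality on products -/

/-- Densities `f`, `g` on `E` are images of a Gaussian-like law in such a way that the quotient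
`q(ax+by) / (f(x)^(a²) g(y)^(b²))` is controlled by `∫ q`, with rigidity of the laws of the
coordinate `l` in the case of equality. -/
def HasTransportBound (a b : ℝ) (E : Type*) [NormedAddCommGroup E] [NormedSpace ℝ E]
    [MeasureSpace E] (l : E → ℝ) : Prop :=
  ∃ (Ω : Type) (_ : MeasurableSpace Ω) (γ : Measure Ω) (w : Ω × Ω → ℝ)
    (T : (E → ℝ≥0∞) → Ω → E), IsProbabilityMeasure γ ∧ Measurable w ∧
    Integrable w (γ.prod γ) ∧ ∫ p, w p ∂(γ.prod γ) = 0 ∧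
    (∀ f, Measurable f → ∫⁻ x, f x = 1 → Measurable (T f) ∧ γ.map (T f) = volume.withDensity f) ∧
    -- Here q need not be the density of aX+bY: the induction on the dimension uses its sections and
    -- marginals.
    ∀ q f g, Measurable q → Measurable f → Measurable g → ∫⁻ x, f x = 1 → ∫⁻ x, g x = 1 →
      ∫⁻ p, ratio a b q f g (w p) (T f p.1) (T g p.2) ∂(γ.prod γ) ≤ ∫⁻ z, q z ∧
      (∫⁻ z, q z ≤ 1 → (∀ᵐ p ∂(γ.prod γ), ratio a b q f g (w p) (T f p.1) (T g p.2) = 1) →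
        GaussianRigid ((volume.withDensity f).map l) ((volume.withDensity g).map l))

theorem isProbabilityMeasure_withDensity_of_lintegral {α : Type*} [MeasurableSpace α]
    {ρ : Measure α} {f : α → ℝ≥0∞} (h : ∫⁻ x, f x ∂ρ = 1) :
    IsProbabilityMeasure (ρ.withDensity f) :=
  ⟨by rw [withDensity_apply _ MeasurableSet.univ, setLIntegral_univ, h]⟩

theorem integrable_mul_stdGauss (c : ℝ) :
    Integrable (fun p : ℝ × ℝ => c * (p.1 * p.2)) (stdGauss.prod stdGauss) := by
  have h : Integrable (fun x : ℝ => x) stdGauss :=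
    (memLp_id_gaussianReal (μ := 0) (v := 1) 1).integrable (by norm_num)
  exact (h.mul_prod h).const_mul c

theorem integral_mul_stdGauss (c : ℝ) :
    ∫ p : ℝ × ℝ, c * (p.1 * p.2) ∂(stdGauss.prod stdGauss) = 0 := by
  rw [integral_const_mul, integral_prod_mul (fun x : ℝ => x) (fun x : ℝ => x),
    integral_id_gaussianReal, zero_mul, mul_zero]

theorem hasTransportBound_real {a b : ℝ} (ha : 0 < a) (hb : 0 < b) (hab : a ^ 2 + b ^ 2 = 1) :
    HasTransportBound a b ℝ id := by
  refine ⟨ℝ, inferInstance, stdGauss, fun p => a * b * (p.1 * p.2),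
    fun f => transport (volume.withDensity f), inferInstance, by fun_prop,
    integrable_mul_stdGauss _, integral_mul_stdGauss _, fun f hf h1 => ?_,
    fun q f g hq hf hg hf1 hg1 => ⟨?_, fun hq1 h => ?_⟩⟩
  · have := isProbabilityMeasure_withDensity_of_lintegral h1
    exact ⟨measurable_transport _, map_transport _⟩
  · have := isProbabilityMeasure_withDensity_of_lintegral hf1
    have := isProbabilityMeasure_withDensity_of_lintegral hg1
    exact lintegral_ratio_transport_le ha hb hab hq hf hg rfl rfl
  · have := isProbabilityMeasure_withDensity_of_lintegral hf1
    have := isProbabilityMeasure_withDensity_of_lintegral hg1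
    rw [Measure.map_id, Measure.map_id]
    exact gaussianRigid_of_ae_deriv_eq (ae_deriv_transport_eq ha hb hab hq hf hg rfl rfl hq1 h)

theorem measurePreserving_prodProdProdComm {α β γ δ : Type*} [MeasurableSpace α]
    [MeasurableSpace β] [MeasurableSpace γ] [MeasurableSpace δ] (μ₁ : Measure α) (μ₂ : Measure β)
    (μ₃ : Measure γ) (μ₄ : Measure δ) [SFinite μ₁] [SFinite μ₂] [SFinite μ₃] [SFinite μ₄] :
    MeasurePreserving (fun p : (α × β) × (γ × δ) => ((p.1.1, p.2.1), (p.1.2, p.2.2)))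
      ((μ₁.prod μ₂).prod (μ₃.prod μ₄)) ((μ₁.prod μ₃).prod (μ₂.prod μ₄)) := by
  have hσ : Measurable fun p : (α × β) × (γ × δ) => ((p.1.1, p.2.1), (p.1.2, p.2.2)) := by fun_prop
  refine ⟨hσ, Measure.ext_of_lintegral _ fun h hh => ?_⟩
  rw [lintegral_map hh hσ, lintegral_prod (fun p : (α × β) × (γ × δ) =>
      h ((p.1.1, p.2.1), (p.1.2, p.2.2))) (hh.comp hσ).aemeasurable,
    lintegral_prod _ hh.aemeasurable,
    lintegral_prod (fun z : α × β => ∫⁻ y : γ × δ, h ((z.1, y.1), (z.2, y.2)) ∂(μ₃.prod μ₄))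
      (Measurable.lintegral_prod_right' (hh.comp hσ)).aemeasurable,
    lintegral_prod _ (Measurable.lintegral_prod_right' hh).aemeasurable]
  refine lintegral_congr fun x => ?_
  have e1 : ∀ s, ∫⁻ p : γ × δ, h ((x, p.1), (s, p.2)) ∂(μ₃.prod μ₄) =
      ∫⁻ y, ∫⁻ r, h ((x, y), (s, r)) ∂μ₄ ∂μ₃ := fun s =>
    lintegral_prod _ (hh.comp (by fun_prop)).aemeasurable
  have e2 : ∀ y, ∫⁻ p : β × δ, h ((x, y), p) ∂(μ₂.prod μ₄) =
      ∫⁻ s, ∫⁻ r, h ((x, y), (s, r)) ∂μ₄ ∂μ₂ := fun y =>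
    lintegral_prod _ (hh.comp (by fun_prop)).aemeasurable
  simp_rw [e1, e2]
  refine lintegral_lintegral_swap (Measurable.aemeasurable ?_)
  exact Measurable.lintegral_prod_right' (f := fun z : (β × γ) × δ => h ((x, z.1.2), (z.1.1, z.2)))
    (hh.comp (by fun_prop))

/-! ### Marginal and conditional densities, and the Knothe map. -/

section

variable {E F : Type*} [MeasureSpace E] [MeasureSpace F]

/-- The marginal density of the first variable. -/
noncomputable def marg (f : E × F → ℝ≥0∞) (x : E) : ℝ≥0∞ := ∫⁻ s, f (x, s)

open scoped Classical in
/-- The conditional density of the last coordinate. -/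
noncomputable def cond (f : E × ℝ → ℝ≥0∞) (x : E) (s : ℝ) : ℝ≥0∞ :=
  if marg f x ≠ 0 ∧ marg f x ≠ ∞ then f (x, s) / marg f x
  -- The default is a probability density, so that the conditional law is a probability measure with
  -- a transport map for every `x`.
  else ENNReal.ofReal (stdPDF s)

theorem measurable_marg [SFinite (volume : Measure F)] {f : E × F → ℝ≥0∞} (hf : Measurable f) :
    Measurable (marg f) :=
  Measurable.lintegral_prod_right' hf

theorem measurable_cond {f : E × ℝ → ℝ≥0∞} (hf : Measurable f) :
    Measurable fun p : E × ℝ => cond f p.1 p.2 := by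
  have hm := measurable_marg hf
  have hm' : Measurable fun p : E × ℝ => marg f p.1 := hm.comp measurable_fst
  unfold cond
  refine Measurable.ite ?_ (hf.div hm')
    (continuous_stdPDF.measurable.comp measurable_snd).ennreal_ofReal
  exact (measurableSet_eq_fun hm' measurable_const).compl.inter
    (measurableSet_eq_fun hm' measurable_const).compl

theorem lintegral_marg [SigmaFinite (volume : Measure E)] [SigmaFinite (volume : Measure F)]
    {f : E × F → ℝ≥0∞} (hf : Measurable f) : ∫⁻ x, marg f x = ∫⁻ p, f p := by
  rw [Measure.volume_eq_prod, lintegral_prod _ hf.aemeasurable]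
  rfl

theorem lintegral_cond (f : E × ℝ → ℝ≥0∞) (hf : Measurable f) (x : E) : ∫⁻ s, cond f x s = 1 := by
  unfold cond
  split_ifs with h
  · simp_rw [div_eq_mul_inv]
    rw [lintegral_mul_const _ (show Measurable fun s => f (x, s) from
      hf.comp (measurable_const.prodMk measurable_id)), ← div_eq_mul_inv]
    exact ENNReal.div_self h.1 h.2
  · exact lintegral_gaussianPDFReal_eq_one 0 one_ne_zero

theorem ae_eq_marg_mul_cond [SigmaFinite (volume : Measure E)] {f : E × ℝ → ℝ≥0∞}
    (hf : Measurable f) (h1 : ∫⁻ p, f p ≠ ∞) :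
    ∀ᵐ p : E × ℝ, f p = marg f p.1 * cond f p.1 p.2 := by
  have hm := measurable_marg hf
  have hc := measurable_cond hf
  rw [Measure.volume_eq_prod]
  refine Measure.ae_prod_mem_iff_ae_ae_mem (s := {p | f p = marg f p.1 * cond f p.1 p.2})
    (measurableSet_eq_fun hf ((hm.comp measurable_fst).mul hc)) |>.2 ?_
  have hfin : ∀ᵐ x, marg f x < ∞ := by
    refine ae_lt_top hm ?_
    rwa [lintegral_marg hf]
  filter_upwards [hfin] with x hx
  by_cases h0 : marg f x = 0
  · have := (lintegral_eq_zero_iff (hf.comp (measurable_const.prodMk measurable_id))).1 h0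
    filter_upwards [this] with s hs
    simpa [h0] using hs
  · refine ae_of_all _ fun s => ?_
    simp only [cond, ne_eq, h0, hx.ne, not_false_eq_true, and_self, if_true]
    rw [ENNReal.mul_div_cancel h0 hx.ne]

/-- The law with the conditional density. -/
noncomputable def condLaw (f : E × ℝ → ℝ≥0∞) (x : E) : Measure ℝ := volume.withDensity (cond f x)

theorem isProbabilityMeasure_condLaw {f : E × ℝ → ℝ≥0∞} (hf : Measurable f) (x : E) :
    IsProbabilityMeasure (condLaw f x) :=
  isProbabilityMeasure_withDensity_of_lintegral (lintegral_cond f hf x)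

/-- By `transport_le_iff` the sublevel sets are cut out by comparing Φ(s) with the conditional
distribution function at z, which is measurable in the parameter. -/
theorem measurable_transport_condLaw {f : E × ℝ → ℝ≥0∞} (hf : Measurable f) :
    Measurable fun p : E × ℝ => transport (condLaw f p.1) p.2 := by
  refine measurable_of_Iic fun z => ?_
  have h : (fun p : E × ℝ => transport (condLaw f p.1) p.2) ⁻¹' Iic z =
      {p | cdf stdGauss p.2 ≤ (∫⁻ s in Iic z, cond f p.1 s).toReal} := by
    ext p
    have := isProbabilityMeasure_withDensity_of_lintegral (lintegral_cond f hf p.1)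
    rw [mem_preimage, mem_Iic, transport_le_iff, mem_ofPred_eq, condLaw, cdf_eq_real
      (volume.withDensity (cond f p.1)), Measure.real, withDensity_apply _ measurableSet_Iic]
  rw [h]
  have hm : Measurable fun x => ∫⁻ s in Iic z, cond f x s :=
    Measurable.lintegral_prod_right' (measurable_cond hf)
  exact measurableSet_le (continuous_cdf_stdGauss.measurable.comp measurable_snd)
    (hm.comp measurable_fst).ennreal_toReal

theorem map_fst_withDensity [SigmaFinite (volume : Measure E)] [SigmaFinite (volume : Measure F)]
    {f : E × F → ℝ≥0∞} (hf : Measurable f) :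
    (volume.withDensity f).map Prod.fst = volume.withDensity (marg f) := by
  ext s hs
  rw [Measure.map_apply measurable_fst hs, withDensity_apply _ (measurable_fst hs),
    withDensity_apply _ hs, ← prod_univ, Measure.volume_eq_prod,
    setLIntegral_prod _ hf.aemeasurable]
  simp [marg]

/-- One step of the Knothe construction: realize the first block, then transport a fresh Gaussian
variable to the conditional law of the last coordinate. -/
theorem map_transport_prod [SigmaFinite (volume : Measure E)] {Ω : Type*} [MeasurableSpace Ω]
    {γ : Measure Ω}
    [IsProbabilityMeasure γ] {f : E × ℝ → ℝ≥0∞} (hf : Measurable f) (h1 : ∫⁻ p, f p = 1)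
    {T : Ω → E} (hT : Measurable T) (hγ : γ.map T = volume.withDensity (marg f)) :
    (γ.prod stdGauss).map (fun p => (T p.1, transport (condLaw f (T p.1)) p.2)) =
      volume.withDensity f := by
  have hm := measurable_marg hf
  have hc := measurable_cond hf
  have hmeas : Measurable fun p : Ω × ℝ => (T p.1, transport (condLaw f (T p.1)) p.2) :=
    (hT.comp measurable_fst).prodMk ((measurable_transport_condLaw hf).comp
      ((hT.comp measurable_fst).prodMk measurable_snd))
  refine Measure.ext_of_lintegral _ fun h hh => ?_
  rw [lintegral_map hh hmeas, lintegral_prod (fun p : Ω × ℝ =>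
    h (T p.1, transport (condLaw f (T p.1)) p.2)) (hh.comp hmeas).aemeasurable]
  have e1 : ∀ x, ∫⁻ s, h (T x, transport (condLaw f (T x)) s) ∂stdGauss =
      ∫⁻ z, cond f (T x) z * h (T x, z) := by
    intro x
    have := isProbabilityMeasure_condLaw hf (T x)
    have hc' : Measurable (cond f (T x)) := hc.comp (measurable_const.prodMk measurable_id)
    have hh' : Measurable fun z => h (T x, z) := hh.comp (measurable_const.prodMk measurable_id)
    have h2 := lintegral_map (μ := stdGauss) hh' (measurable_transport (condLaw f (T x)))
    rw [← h2, map_transport (μ := condLaw f (T x)), condLaw,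
      lintegral_withDensity_eq_lintegral_mul _ hc' hh']
    rfl
  simp_rw [e1]
  have hF : Measurable fun x => ∫⁻ z, cond f x z * h (x, z) :=
    Measurable.lintegral_prod_right' (f := fun p : E × ℝ => cond f p.1 p.2 * h p) (hc.mul hh)
  rw [← lintegral_map (μ := γ) hF hT, hγ, lintegral_withDensity_eq_lintegral_mul _ hm hF,
    lintegral_withDensity_eq_lintegral_mul _ hf hh]
  have e2 : ∀ x, (marg f * fun x => ∫⁻ z, cond f x z * h (x, z)) x =
      ∫⁻ z, marg f x * cond f x z * h (x, z) := by
    intro x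
    rw [Pi.mul_apply, ← lintegral_const_mul]
    · simp_rw [mul_assoc]
    · exact (hc.mul hh).comp (measurable_const.prodMk measurable_id)
  simp_rw [e2]
  rw [Measure.volume_eq_prod, ← lintegral_prod (fun p : E × ℝ => marg f p.1 * cond f p.1 p.2 * h p)
    (((hm.comp measurable_fst).mul hc).mul hh).aemeasurable]
  refine lintegral_congr_ae ?_
  have := ae_eq_marg_mul_cond hf (by rw [h1]; exact ENNReal.one_ne_top)
  rw [Measure.volume_eq_prod] at this
  filter_upwards [this] with p hp
  rw [Pi.mul_apply, hp]

end

/-! ### Tensorization -/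

/-- The factorization of a density into marginal and conditional splits the quotient. The
nonvanishing hypotheses matter because a negative power of a product in `ℝ≥0∞` need not split at
zero. -/
theorem ratio_prod_eq {E : Type*} [NormedAddCommGroup E] [NormedSpace ℝ E] {a b : ℝ} {q f g : E × ℝ → ℝ≥0∞} {X Y : E} {s r : ℝ} (w w' : ℝ)
    (hf : f (X, s) = marg f X * cond f X s) (hg : g (Y, r) = marg g Y * cond g Y r)
    (hf0 : f (X, s) ≠ 0) (hg0 : g (Y, r) ≠ 0) :
    ratio a b q f g (w + w') (X, s) (Y, r) =
      (ENNReal.ofReal (Real.exp w) * marg f X ^ (-a ^ 2) * marg g Y ^ (-b ^ 2)) *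
        ratio a b (fun z => q (a • X + b • Y, z)) (cond f X) (cond g Y) w' s r := by
  rw [hf, mul_ne_zero_iff] at hf0
  rw [hg, mul_ne_zero_iff] at hg0
  simp only [ratio]
  rw [hf, hg, ENNReal.mul_rpow_of_ne_zero hf0.1 hf0.2, ENNReal.mul_rpow_of_ne_zero hg0.1 hg0.2,
    Real.exp_add, ENNReal.ofReal_mul (Real.exp_pos _).le]
  simp only [Prod.smul_mk, Prod.mk_add_mk]
  ring

section

variable {E : Type*} [NormedAddCommGroup E] [NormedSpace ℝ E] [MeasureSpace E] [BorelSpace E]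
  [SecondCountableTopology E]

theorem measurable_ratio {Ω : Type*} [MeasurableSpace Ω] (a b : ℝ) {q f g : E → ℝ≥0∞}
    (hq : Measurable q) (hf : Measurable f) (hg : Measurable g) {w : Ω → ℝ} (hw : Measurable w)
    {X Y : Ω → E} (hX : Measurable X) (hY : Measurable Y) :
    Measurable fun o => ratio a b q f g (w o) (X o) (Y o) := by
  unfold ratio
  have h1 : Measurable fun o => q (a • X o + b • Y o) :=
    hq.comp ((hX.const_smul a).add (hY.const_smul b))
  exact ((h1.mul hw.exp.ennreal_ofReal).mul ((hf.comp hX).pow_const _)).mul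
    ((hg.comp hY).pow_const _)

/-- After the factorization of the quotient, the one-dimensional bound integrates out the two new
Gaussian variables and replaces q by its marginal; what remains is the quotient of the marginals, to
which the hypothesis applies. Rigidity is only propagated from the first block. -/
theorem HasTransportBound.prod_real [SigmaFinite (volume : Measure E)] {a b : ℝ} (ha : 0 < a)
    (hb : 0 < b) (hab : a ^ 2 + b ^ 2 = 1)
    {l : E → ℝ} (hl : Measurable l) (h : HasTransportBound a b E l) :
    HasTransportBound a b (E × ℝ) fun p => l p.1 := by
  obtain ⟨Ω, mΩ, γ, w, T, hγ, hw, hwi, hw0, hT, hmain⟩ := h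
  have hσ := measurePreserving_prodProdProdComm γ γ stdGauss stdGauss
  have hσ' := measurePreserving_prodProdProdComm γ stdGauss γ stdGauss
  have hTm : ∀ {f : E × ℝ → ℝ≥0∞}, Measurable f → ∫⁻ p, f p = 1 →
      Measurable (T (marg f)) ∧ γ.map (T (marg f)) = volume.withDensity (marg f) :=
    fun hf h1 => hT _ (measurable_marg hf) (by rwa [lintegral_marg hf])
  have hT' : ∀ f : E × ℝ → ℝ≥0∞, Measurable f → ∫⁻ p, f p = 1 →
      Measurable fun p : Ω × ℝ => (T (marg f) p.1, transport (condLaw f (T (marg f) p.1)) p.2) :=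
    fun f hf h1 => ((hTm hf h1).1.comp measurable_fst).prodMk
      ((measurable_transport_condLaw hf).comp
        (((hTm hf h1).1.comp measurable_fst).prodMk measurable_snd))
  have hae : ∀ f : E × ℝ → ℝ≥0∞, Measurable f → ∫⁻ p, f p = 1 → ∀ᵐ p ∂(γ.prod stdGauss),
      (fun z : E × ℝ => f z = marg f z.1 * cond f z.1 z.2 ∧ f z ≠ 0)
        (T (marg f) p.1, transport (condLaw f (T (marg f) p.1)) p.2) := by
    intro f hf h1
    refine ae_of_ae_map (p := fun z : E × ℝ => f z = marg f z.1 * cond f z.1 z.2 ∧ f z ≠ 0)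
      (hT' f hf h1).aemeasurable ?_
    rw [map_transport_prod hf h1 (hTm hf h1).1 (hTm hf h1).2]
    have e1 : ∀ᵐ z ∂(volume.withDensity f), f z = marg f z.1 * cond f z.1 z.2 :=
      (withDensity_absolutelyContinuous _ _).ae_le
        (ae_eq_marg_mul_cond hf (by rw [h1]; exact ENNReal.one_ne_top))
    have e2 : ∀ᵐ z ∂(volume.withDensity f), f z ≠ 0 := by
      rw [ae_withDensity_iff hf]
      exact ae_of_all _ fun _ h => h
    exact e1.and e2
  refine ⟨Ω × ℝ, inferInstance, γ.prod stdGauss,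
    fun p => w (p.1.1, p.2.1) + a * b * (p.1.2 * p.2.2),
    fun f p => (T (marg f) p.1, transport (condLaw f (T (marg f) p.1)) p.2), inferInstance,
    by fun_prop, ?_, ?_, fun f hf h1 => ⟨hT' f hf h1, map_transport_prod hf h1 (hTm hf h1).1
      (hTm hf h1).2⟩, fun q f g hq hf hg hf1 hg1 => ?_⟩
  · have := (hwi.comp_fst (stdGauss.prod stdGauss)).add
      ((integrable_mul_stdGauss (a * b)).comp_snd (γ.prod γ))
    exact hσ'.integrable_comp_of_integrable this
  · have e := hσ'.map_eq
    have := integral_map (μ := (γ.prod stdGauss).prod (γ.prod stdGauss))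
      (φ := fun p => ((p.1.1, p.2.1), (p.1.2, p.2.2))) hσ'.measurable.aemeasurable
      (f := fun z : (Ω × Ω) × (ℝ × ℝ) => w z.1 + a * b * (z.2.1 * z.2.2))
      (by fun_prop)
    rw [e] at this
    rw [← this, integral_add (hwi.comp_fst _) ((integrable_mul_stdGauss (a * b)).comp_snd _)]
    rw [integral_fun_fst (μ := γ.prod γ) (ν := stdGauss.prod stdGauss) w,
      integral_fun_snd (μ := γ.prod γ) (ν := stdGauss.prod stdGauss)
        (fun z : ℝ × ℝ => a * b * (z.1 * z.2)), hw0, integral_mul_stdGauss]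
    simp
  set K : (Ω × ℝ) × (Ω × ℝ) → ℝ≥0∞ := fun p =>
    ratio a b q f g (w (p.1.1, p.2.1) + a * b * (p.1.2 * p.2.2))
      (T (marg f) p.1.1, transport (condLaw f (T (marg f) p.1.1)) p.1.2)
      (T (marg g) p.2.1, transport (condLaw g (T (marg g) p.2.1)) p.2.2) with hK
  have hKm : Measurable K := measurable_ratio a b hq hf hg
    (w := fun p : (Ω × ℝ) × (Ω × ℝ) => w (p.1.1, p.2.1) + a * b * (p.1.2 * p.2.2))
    (by fun_prop) ((hT' f hf hf1).comp measurable_fst) ((hT' g hg hg1).comp measurable_snd)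
  set K' : (Ω × Ω) × (ℝ × ℝ) → ℝ≥0∞ := fun z => K ((z.1.1, z.2.1), (z.1.2, z.2.2)) with hK'
  have hKm' : Measurable K' := hKm.comp hσ.measurable
  set B : Ω × Ω → ℝ≥0∞ := fun z => ENNReal.ofReal (Real.exp (w z)) *
    marg f (T (marg f) z.1) ^ (-a ^ 2) * marg g (T (marg g) z.2) ^ (-b ^ 2) with hB
  set R : Ω × Ω → ℝ × ℝ → ℝ≥0∞ := fun z y =>
    ratio a b (fun s => q (a • T (marg f) z.1 + b • T (marg g) z.2, s))
      (cond f (T (marg f) z.1)) (cond g (T (marg g) z.2)) (a * b * (y.1 * y.2))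
      (transport (condLaw f (T (marg f) z.1)) y.1)
      (transport (condLaw g (T (marg g) z.2)) y.2) with hR
  have hcond : ∀ {f : E × ℝ → ℝ≥0∞}, Measurable f → ∀ x, Measurable (cond f x) := fun hf x =>
    (measurable_cond hf).comp (measurable_const.prodMk measurable_id)
  have hqm : ∀ x, Measurable fun s => q (x, s) := fun x =>
    hq.comp (measurable_const.prodMk measurable_id)
  have hfact : ∀ᵐ z ∂((γ.prod γ).prod (stdGauss.prod stdGauss)), K' z = B z.1 * R z.1 z.2 := by
    have e1 := ((measurePreserving_fst (μ := γ) (ν := γ)).prod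
      (measurePreserving_fst (μ := stdGauss) (ν := stdGauss))).quasiMeasurePreserving.ae
      (hae f hf hf1)
    have e2 := ((measurePreserving_snd (μ := γ) (ν := γ)).prod
      (measurePreserving_snd (μ := stdGauss) (ν := stdGauss))).quasiMeasurePreserving.ae
      (hae g hg hg1)
    filter_upwards [e1, e2] with z hz1 hz2
    exact ratio_prod_eq _ _ hz1.1 hz2.1 hz1.2 hz2.2
  have hR1 : ∀ z, ∫⁻ y, R z y ∂(stdGauss.prod stdGauss) ≤
      marg q (a • T (marg f) z.1 + b • T (marg g) z.2) := by
    intro z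
    have := isProbabilityMeasure_condLaw hf (T (marg f) z.1)
    have := isProbabilityMeasure_condLaw hg (T (marg g) z.2)
    exact lintegral_ratio_transport_le ha hb hab (hqm _) (hcond hf _) (hcond hg _) rfl rfl
  have hRm : ∀ z, Measurable (R z) := fun z =>
    measurable_ratio a b (hqm _) (hcond hf _) (hcond hg _)
      (w := fun y : ℝ × ℝ => a * b * (y.1 * y.2)) (by fun_prop)
      ((measurable_transport _).comp measurable_fst) ((measurable_transport _).comp measurable_snd)
  have hinner : ∀ᵐ z ∂(γ.prod γ), ∫⁻ y, K' (z, y) ∂(stdGauss.prod stdGauss) ≤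
      ratio a b (marg q) (marg f) (marg g) (w z) (T (marg f) z.1) (T (marg g) z.2) := by
    filter_upwards [Measure.ae_ae_of_ae_prod hfact] with z hz
    rw [lintegral_congr_ae hz, lintegral_const_mul _ (hRm z)]
    refine (mul_le_mul_right (hR1 z) (B z)).trans (le_of_eq ?_)
    simp only [hB, ratio]
    ring
  obtain ⟨hle, hrig⟩ := hmain (marg q) (marg f) (marg g) (measurable_marg hq) (measurable_marg hf)
    (measurable_marg hg) (by rwa [lintegral_marg hf]) (by rwa [lintegral_marg hg])
  refine ⟨?_, fun hq1 h1 => ?_⟩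
  · rw [← hσ.lintegral_comp hKm, lintegral_prod (fun z => K' z) hKm'.aemeasurable]
    calc _ ≤ _ := lintegral_mono_ae hinner
      _ ≤ _ := hle
      _ = _ := lintegral_marg hq
  -- If the full quotient is 1, its inner integral is 1, so the marginal quotient is at least 1 with
  -- integral at most 1, hence equal to 1.
  · have h2 : ∀ᵐ z ∂((γ.prod γ).prod (stdGauss.prod stdGauss)), K' z = 1 :=
      hσ.quasiMeasurePreserving.ae h1
    have h3 : ∀ᵐ z ∂(γ.prod γ),
        ratio a b (marg q) (marg f) (marg g) (w z) (T (marg f) z.1) (T (marg g) z.2) = 1 := by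
      refine ae_eq_one_of_one_le (measurable_ratio a b (measurable_marg hq) (measurable_marg hf)
        (measurable_marg hg) hw ((hTm hf hf1).1.comp measurable_fst)
        ((hTm hg hg1).1.comp measurable_snd)).aemeasurable ?_
        (hle.trans (by rwa [lintegral_marg hq]))
      filter_upwards [hinner, Measure.ae_ae_of_ae_prod h2] with z hz1 hz2
      rw [lintegral_congr_ae hz2] at hz1
      simpa using hz1
    have h4 := hrig (by rwa [lintegral_marg hq]) h3
    rwa [← map_fst_withDensity hf, ← map_fst_withDensity hg, Measure.map_map hl measurable_fst,
      Measure.map_map hl measurable_fst] at h4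

end

/-! ### The transport inequality on Euclidean spaces -/

theorem map_withDensity_comp {α β : Type*} [MeasurableSpace α] [MeasurableSpace β]
    {μ : Measure α} {ν : Measure β} {e : α → β} (he : MeasurePreserving e μ ν) {f : β → ℝ≥0∞}
    (hf : Measurable f) : (μ.withDensity fun x => f (e x)).map e = ν.withDensity f := by
  ext s hs
  rw [Measure.map_apply he.measurable hs, withDensity_apply _ (he.measurable hs),
    withDensity_apply _ hs, ← lintegral_indicator hs, ← lintegral_indicator (he.measurable hs),
    ← he.lintegral_comp (hf.indicator hs)]
  rfl

section

variable {E F : Type*} [NormedAddCommGroup E] [NormedSpace ℝ E] [MeasureSpace E]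
  [NormedAddCommGroup F] [NormedSpace ℝ F] [MeasureSpace F]

/-- Linearity of `e` makes it commute with aX + bY, and preservation of volume carries densities to
densities, so the quotient is unchanged. -/
theorem HasTransportBound.map {a b : ℝ} {l : F → ℝ} (hl : Measurable l) (e : E →ₗ[ℝ] F)
    (he : MeasurePreserving e) (h : HasTransportBound a b E fun x => l (e x)) :
    HasTransportBound a b F l := by
  obtain ⟨Ω, mΩ, γ, w, T, hγ, hw, hwi, hw0, hT, hmain⟩ := h
  have hint : ∀ {f : F → ℝ≥0∞}, Measurable f → ∫⁻ x, f (e x) = ∫⁻ x, f x := fun hf =>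
    he.lintegral_comp hf
  have hratio : ∀ (q f g : F → ℝ≥0∞) (w : ℝ) (x y : E), ratio a b q f g w (e x) (e y) =
      ratio a b (fun x => q (e x)) (fun x => f (e x)) (fun x => g (e x)) w x y := by
    intro q f g w x y
    simp [ratio]
  refine ⟨Ω, mΩ, γ, w, fun f o => e (T (fun x => f (e x)) o), hγ, hw, hwi, hw0,
    fun f hf h1 => ?_, fun q f g hq hf hg hf1 hg1 => ?_⟩
  · obtain ⟨h2, h3⟩ := hT (fun x => f (e x)) (hf.comp he.measurable) (by rwa [hint hf])
    refine ⟨he.measurable.comp h2, ?_⟩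
    rw [← map_withDensity_comp he hf, ← h3, Measure.map_map he.measurable h2]
    rfl
  · have := hmain (fun x => q (e x)) (fun x => f (e x)) (fun x => g (e x))
      (hq.comp he.measurable) (hf.comp he.measurable) (hg.comp he.measurable)
      (by rwa [hint hf]) (by rwa [hint hg])
    simp only [hratio]
    rw [hint hq] at this
    refine ⟨this.1, fun h1 h2 => ?_⟩
    have h3 := this.2 h1 h2
    rwa [← map_withDensity_comp he hf, ← map_withDensity_comp he hg,
      Measure.map_map hl he.measurable, Measure.map_map hl he.measurable]

end

theorem hasTransportBound_pi {a b : ℝ} (ha : 0 < a) (hb : 0 < b) (hab : a ^ 2 + b ^ 2 = 1) (n : ℕ) :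
    HasTransportBound a b (ℝ × (Fin n → ℝ)) fun p => p.1 := by
  induction n with
  | zero =>
    -- Volume on the space of functions on the empty type is a Dirac mass, so adjoining this factor
    -- changes nothing.
    have he : MeasurePreserving (LinearMap.inl ℝ ℝ (Fin 0 → ℝ)) := by
      have : IsProbabilityMeasure (volume : Measure (Fin 0 → ℝ)) := by
        rw [Measure.volume_pi_eq_dirac 0]; infer_instance
      have h1 : MeasurePreserving (Prod.fst : ℝ × (Fin 0 → ℝ) → ℝ) := measurePreserving_fst
      have hm : Measurable (LinearMap.inl ℝ ℝ (Fin 0 → ℝ)) := by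
        simp only [LinearMap.coe_inl]; fun_prop
      refine ⟨hm, ?_⟩
      rw [← h1.map_eq, Measure.map_map hm measurable_fst]
      convert Measure.map_id
      ext p : 1
      exact Prod.ext rfl (Subsingleton.elim _ _)
    exact HasTransportBound.map measurable_fst _ he (hasTransportBound_real ha hb hab)
  | succ n ih =>
    -- The new coordinate enters at index 0 of the tuple; the distinguished real coordinate stays
    -- first.
    let e : (ℝ × (Fin n → ℝ)) × ℝ →ₗ[ℝ] ℝ × (Fin (n + 1) → ℝ) :=
      { toFun := fun p => (p.1.1, Fin.cons p.2 p.1.2)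
        map_add' := fun p q => by
          refine Prod.ext rfl (funext fun i => ?_)
          refine Fin.cases ?_ (fun i => ?_) i <;> simp
        map_smul' := fun c p => by
          refine Prod.ext rfl (funext fun i => ?_)
          refine Fin.cases ?_ (fun i => ?_) i <;> simp }
    have he : MeasurePreserving e := by
      have h1 := (MeasurePreserving.id (volume : Measure ℝ)).prod
        (((volume_preserving_piFinSuccAbove (fun _ : Fin (n + 1) => ℝ) 0).symm).comp
          (Measure.measurePreserving_swap (μ := (volume : Measure (Fin n → ℝ)))
            (ν := (volume : Measure ℝ))))
      have h2 := h1.comp (volume_preserving_prodAssoc (α₁ := ℝ) (β₁ := Fin n → ℝ) (γ₁ := ℝ))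
      convert! h2 using 1
      ext p : 1
      refine Prod.ext rfl (funext fun i => ?_)
      refine Fin.cases ?_ (fun i => ?_) i <;>
        simp [e, MeasurableEquiv.piFinSuccAbove, MeasurableEquiv.prodAssoc]
    exact HasTransportBound.map measurable_fst e he
      (HasTransportBound.prod_real ha hb hab measurable_fst ih)

/-- The shear (s, x) ↦ (s - ⟨v,x⟩, x) preserves volume and pulls s + ⟨v,x⟩ back to the first
coordinate, the one for which rigidity is known. -/
theorem hasTransportBound_euclidean {a b : ℝ} (ha : 0 < a) (hb : 0 < b) (hab : a ^ 2 + b ^ 2 = 1)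
    (n : ℕ) (v : EuclideanSpace ℝ (Fin n)) :
    HasTransportBound a b (ℝ × EuclideanSpace ℝ (Fin n)) fun p => p.1 + inner ℝ v p.2 := by
  let e : ℝ × (Fin n → ℝ) →ₗ[ℝ] ℝ × EuclideanSpace ℝ (Fin n) :=
    { toFun := fun p => (p.1 - inner ℝ v (WithLp.toLp 2 p.2), WithLp.toLp 2 p.2)
      map_add' := fun p q => by
        simp only [Prod.fst_add, Prod.snd_add, WithLp.toLp_add, inner_add_right, Prod.mk_add_mk]
        congr 1
        ring
      map_smul' := fun c p => by
        simp only [Prod.smul_fst, Prod.smul_snd, WithLp.toLp_smul, inner_smul_right, Prod.smul_mk,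
          RingHom.id_apply, smul_eq_mul]
        congr 1
        ring }
  have he : MeasurePreserving e := by
    have h1 : MeasurePreserving (fun p : (Fin n → ℝ) × ℝ =>
        (WithLp.toLp 2 p.1, p.2 - inner ℝ v (WithLp.toLp 2 p.1))) (volume.prod volume)
        ((volume : Measure (EuclideanSpace ℝ (Fin n))).prod volume) :=
      (PiLp.volume_preserving_toLp (Fin n)).skew_product
        (g := fun x s => s - inner ℝ v (WithLp.toLp 2 x)) (by fun_prop)
        (ae_of_all _ fun x => (measurePreserving_sub_right volume _).map_eq)
    exact (Measure.measurePreserving_swap.comp h1).comp Measure.measurePreserving_swap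
  refine HasTransportBound.map (by fun_prop) e he ?_
  have := hasTransportBound_pi ha hb hab n
  simpa [e] using this

/-! ### Adjoining an independent Gaussian coordinate. -/

theorem continuous_gaussian_smoothing (ζ : Measure ℝ) [IsProbabilityMeasure ζ] :
    Continuous (fun z => ∫ y, stdPDF (z - y) ∂ζ) ∧ ∀ z, 0 < ∫ y, stdPDF (z - y) ∂ζ := by
  have hb : ∀ x, stdPDF x ≤ (√(2 * Real.pi))⁻¹ := fun x => by
    rw [stdPDF_eq]
    exact mul_le_of_le_one_right (by positivity) (Real.exp_le_one_iff.2 (by nlinarith [sq_nonneg x]))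
  have hb' : ∀ z, ∀ᵐ y ∂ζ, ‖stdPDF (z - y)‖ ≤ (√(2 * Real.pi))⁻¹ := fun z => ae_of_all _ fun y => by
    rw [Real.norm_of_nonneg (stdPDF_pos _).le]
    exact hb _
  have hm : ∀ z, AEStronglyMeasurable (fun y => stdPDF (z - y)) ζ := fun z =>
    (continuous_stdPDF.comp (by fun_prop)).aestronglyMeasurable
  refine ⟨continuous_of_dominated hm hb' (integrable_const _) (ae_of_all _ fun y =>
    continuous_stdPDF.comp (by fun_prop)), fun z => ?_⟩
  rw [integral_pos_iff_support_of_nonneg (fun y => (stdPDF_pos _).le)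
    (Integrable.of_bound (hm z) _ (hb' z))]
  have : Function.support (fun y => stdPDF (z - y)) = univ :=
    eq_univ_of_forall fun y => (stdPDF_pos _).ne'
  rw [this]
  simp

/-- The sum of a standard Gaussian variable and an independent variable has a regular density. -/
theorem hasRegularDensity_map_add {α : Type*} [MeasurableSpace α] {μ : Measure α}
    [IsProbabilityMeasure μ] {h : α → ℝ} (hh : Measurable h) :
    HasRegularDensity ((stdGauss.prod μ).map fun p => p.1 + h p.2) := by
  have : IsProbabilityMeasure (μ.map h) := Measure.isProbabilityMeasure_map hh.aemeasurable
  obtain ⟨hc, hp⟩ := continuous_gaussian_smoothing (μ.map h)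
  refine ⟨_, hc, hp, Measure.ext_of_lintegral _ fun u hu => ?_⟩
  have hφ := continuous_stdPDF.measurable.ennreal_ofReal
  have hφz : ∀ z : ℝ, Measurable fun y => ENNReal.ofReal (stdPDF (z - y)) := fun z =>
    hφ.comp (measurable_const.sub measurable_id)
  have h1 : ∀ z, ENNReal.ofReal (∫ y, stdPDF (z - y) ∂(μ.map h)) =
      ∫⁻ x, ENNReal.ofReal (stdPDF (z - h x)) ∂μ := by
    intro z
    have e1 : ∫⁻ y, ENNReal.ofReal (stdPDF (z - y)) ∂(μ.map h) =
      ∫⁻ x, ENNReal.ofReal (stdPDF (z - h x)) ∂μ := lintegral_map (hφz z) hh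
    rw [← e1, ofReal_integral_eq_lintegral_ofReal _ (ae_of_all _ fun y => (stdPDF_pos _).le)]
    by_contra hn
    have := hp z
    rw [integral_undef hn] at this
    exact lt_irrefl _ this
  have hm2 : Measurable fun p : ℝ × α => ENNReal.ofReal (stdPDF (p.1 - h p.2)) :=
    hφ.comp (measurable_fst.sub (hh.comp measurable_snd))
  rw [lintegral_map hu (by fun_prop), lintegral_prod_symm (fun p : ℝ × α => u (p.1 + h p.2))
    (hu.comp (measurable_fst.add (hh.comp measurable_snd))).aemeasurable,
    lintegral_withDensity_eq_lintegral_mul _ hc.measurable.ennreal_ofReal hu]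
  have h2 : ∀ x, ∫⁻ s, u (s + h x) ∂stdGauss = ∫⁻ z, ENNReal.ofReal (stdPDF (z - h x)) * u z := by
    intro x
    rw [stdGauss_eq, lintegral_withDensity_eq_lintegral_mul _ hφ
      (show Measurable fun s => u (s + h x) from hu.comp (measurable_id.add_const (h x)))]
    rw [← lintegral_add_right_eq_self (fun z => ENNReal.ofReal (stdPDF (z - h x)) * u z) (h x)]
    simp
  simp_rw [h2, Pi.mul_apply, h1]
  rw [lintegral_lintegral_swap ((hm2.comp measurable_swap).mul
    (hu.comp measurable_snd)).aemeasurable]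
  refine lintegral_congr fun z => ?_
  exact lintegral_mul_const _ (show Measurable fun x => ENNReal.ofReal (stdPDF (z - h x)) from
    hφ.comp (measurable_const.sub hh))

/-- The law of `N + ⟨v, X⟩` where `X` has law `μ` and `N` is an independent standard Gaussian. -/
noncomputable def smoothedMarginal {n : ℕ} (μ : Measure (EuclideanSpace ℝ (Fin n)))
    (v : EuclideanSpace ℝ (Fin n)) : Measure ℝ :=
  (stdGauss.prod μ).map fun p => p.1 + inner ℝ v p.2

/-- The adjoined Gaussian factors contribute φ(as+br) / (φ(s)^(a²) φ(r)^(b²)) = e^(-absr), which is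
absorbed into the weight. -/
theorem ratio_stdPDF_mul {E : Type*} [NormedAddCommGroup E] [NormedSpace ℝ E] {a b : ℝ}
    (hab : a ^ 2 + b ^ 2 = 1) (q f g : E → ℝ≥0∞) (w : ℝ) (X Y : ℝ × E) :
    ratio a b (fun p : ℝ × E => ENNReal.ofReal (stdPDF p.1) * q p.2)
      (fun p => ENNReal.ofReal (stdPDF p.1) * f p.2) (fun p => ENNReal.ofReal (stdPDF p.1) * g p.2)
      w X Y = ratio a b q f g (w - a * b * (X.1 * Y.1)) X.2 Y.2 := by
  have h0 : ∀ x, ENNReal.ofReal (stdPDF x) ≠ 0 := fun x => by simpa using stdPDF_pos x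
  have hmul : ∀ (x : ℝ) (c : ℝ≥0∞) (r : ℝ), (ENNReal.ofReal (stdPDF x) * c) ^ (-r ^ 2) =
      ENNReal.ofReal (stdPDF x ^ (-r ^ 2)) * c ^ (-r ^ 2) := by
    intro x c r
    rw [← ENNReal.ofReal_rpow_of_pos (stdPDF_pos x)]
    by_cases hr : r = 0
    · simp [hr]
    have hr' : 0 < r ^ 2 := by positivity
    by_cases hc : c = 0
    · rw [hc, mul_zero, ENNReal.zero_rpow_of_neg (by linarith), ENNReal.mul_top]
      rw [ENNReal.ofReal_rpow_of_pos (stdPDF_pos x)]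
      simpa using Real.rpow_pos_of_pos (stdPDF_pos x) _
    · exact ENNReal.mul_rpow_of_ne_zero (h0 x) hc _
  have hexp : stdPDF (a * X.1 + b * Y.1) * Real.exp w * stdPDF X.1 ^ (-a ^ 2) *
      stdPDF Y.1 ^ (-b ^ 2) = Real.exp (w - a * b * (X.1 * Y.1)) := by
    have h := exp_mul_rpow_neg_mul_rpow_neg hab (stdPDF_pos X.1) (stdPDF_pos Y.1)
      (mul_one _) (mul_one _)
    rw [Real.one_rpow, Real.one_rpow, mul_one, eq_div_iff (stdPDF_pos _).ne'] at h
    rw [Real.exp_sub, eq_div_iff (Real.exp_pos _).ne']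
    linear_combination Real.exp w * h
  simp only [ratio, hmul, Prod.fst_add, Prod.snd_add, Prod.smul_fst, Prod.smul_snd, smul_eq_mul]
  have p1 := (stdPDF_pos (a * X.1 + b * Y.1)).le
  have p2 := mul_nonneg p1 (Real.exp_pos w).le
  rw [← hexp, ENNReal.ofReal_mul (mul_nonneg p2 (Real.rpow_nonneg (stdPDF_pos _).le _)),
    ENNReal.ofReal_mul p2, ENNReal.ofReal_mul p1]
  ring

/-- Random vectors `X`, `Y` with densities `f`, `g` can be realized, together with a centred
random variable `w`, in such a way that the mean of `q(aX+bY) eʷ / (f(X)^(a²) g(Y)^(b²))` is at most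
`∫ q`. -/
theorem exists_coupling {a b : ℝ} (ha : 0 < a) (hb : 0 < b) (hab : a ^ 2 + b ^ 2 = 1) {n : ℕ}
    (v : EuclideanSpace ℝ (Fin n)) {f g : EuclideanSpace ℝ (Fin n) → ℝ≥0∞}
    (hf : Measurable f) (hg : Measurable g) (hf1 : ∫⁻ x, f x = 1) (hg1 : ∫⁻ x, g x = 1) :
    ∃ (Ω : Type) (_ : MeasurableSpace Ω) (ρ : Measure Ω) (w : Ω → ℝ)
      (X Y : Ω → EuclideanSpace ℝ (Fin n)), IsProbabilityMeasure ρ ∧ Measurable w ∧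
      Integrable w ρ ∧ ∫ o, w o ∂ρ = 0 ∧ Measurable X ∧ Measurable Y ∧
      ρ.map (fun o => (X o, Y o)) = (volume.withDensity f).prod (volume.withDensity g) ∧
      ∀ q, Measurable q → ∫⁻ o, ratio a b q f g (w o) (X o) (Y o) ∂ρ ≤ ∫⁻ z, q z ∧
        (∫⁻ z, q z ≤ 1 → (∀ᵐ o ∂ρ, ratio a b q f g (w o) (X o) (Y o) = 1) →
          ∃ m₁ m₂ s, smoothedMarginal (volume.withDensity f) v = gaussianReal m₁ s ∧
            smoothedMarginal (volume.withDensity g) v = gaussianReal m₂ s) := by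
  obtain ⟨Ω, mΩ, γ, w, T, hγ, hw, hwi, hw0, hT, hmain⟩ := hasTransportBound_euclidean ha hb hab n v
  have hφ := continuous_stdPDF.measurable.ennreal_ofReal
  have hφ1 : ∫⁻ s, ENNReal.ofReal (stdPDF s) = 1 := lintegral_gaussianPDFReal_eq_one 0 one_ne_zero
  have hmeas : ∀ {f : EuclideanSpace ℝ (Fin n) → ℝ≥0∞}, Measurable f →
      Measurable fun p : ℝ × EuclideanSpace ℝ (Fin n) => ENNReal.ofReal (stdPDF p.1) * f p.2 :=
    fun hf => (hφ.comp measurable_fst).mul (hf.comp measurable_snd)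
  have hint : ∀ {f : EuclideanSpace ℝ (Fin n) → ℝ≥0∞}, Measurable f →
      ∫⁻ p : ℝ × EuclideanSpace ℝ (Fin n), ENNReal.ofReal (stdPDF p.1) * f p.2 = ∫⁻ x, f x := by
    intro f hf
    rw [Measure.volume_eq_prod, lintegral_prod_mul hφ.aemeasurable hf.aemeasurable, hφ1, one_mul]
  have hdens : ∀ {f : EuclideanSpace ℝ (Fin n) → ℝ≥0∞}, Measurable f →
      (volume : Measure (ℝ × EuclideanSpace ℝ (Fin n))).withDensity
        (fun p => ENNReal.ofReal (stdPDF p.1) * f p.2) = stdGauss.prod (volume.withDensity f) := by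
    intro f hf
    rw [stdGauss_eq, prod_withDensity hφ hf, Measure.volume_eq_prod]
  set F : ℝ × EuclideanSpace ℝ (Fin n) → ℝ≥0∞ := fun p => ENNReal.ofReal (stdPDF p.1) * f p.2
  set G : ℝ × EuclideanSpace ℝ (Fin n) → ℝ≥0∞ := fun p => ENNReal.ofReal (stdPDF p.1) * g p.2
  obtain ⟨hTF, hTF'⟩ := hT F (hmeas hf) (by rw [hint hf, hf1])
  obtain ⟨hTG, hTG'⟩ := hT G (hmeas hg) (by rw [hint hg, hg1])
  have := isProbabilityMeasure_withDensity_of_lintegral hf1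
  have := isProbabilityMeasure_withDensity_of_lintegral hg1
  rw [hdens hf] at hTF'
  rw [hdens hg] at hTG'
  have hN : ∀ {R : Ω → ℝ × EuclideanSpace ℝ (Fin n)}, Measurable R →
      ∀ {μ : Measure (EuclideanSpace ℝ (Fin n))} [IsProbabilityMeasure μ],
      γ.map R = stdGauss.prod μ → MeasurePreserving (fun o => (R o).1) γ stdGauss ∧
        MeasurePreserving (fun o => (R o).2) γ μ := by
    intro R hR μ _ h
    have h1 : MeasurePreserving R γ (stdGauss.prod μ) := ⟨hR, h⟩
    exact ⟨measurePreserving_fst.comp h1, measurePreserving_snd.comp h1⟩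
  obtain ⟨hF1, hF2⟩ := hN hTF hTF'
  obtain ⟨hG1, hG2⟩ := hN hTG hTG'
  have hFG := hF1.prod hG1
  -- The correction to the weight is a multiple of a product of two independent standard Gaussian
  -- variables, so the new weight is still integrable and centred.
  have hi : Integrable (fun p : Ω × Ω => a * b * ((T F p.1).1 * (T G p.2).1)) (γ.prod γ) :=
    hFG.integrable_comp_of_integrable (integrable_mul_stdGauss (a * b))
  have hi0 : ∫ p : Ω × Ω, a * b * ((T F p.1).1 * (T G p.2).1) ∂(γ.prod γ) = 0 := by
    have := integral_map (μ := γ.prod γ) hFG.measurable.aemeasurable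
      (f := fun z : ℝ × ℝ => a * b * (z.1 * z.2)) (by fun_prop)
    rw [hFG.map_eq, integral_mul_stdGauss] at this
    exact this.symm
  refine ⟨Ω × Ω, inferInstance, γ.prod γ, fun p => w p - a * b * ((T F p.1).1 * (T G p.2).1),
    fun p => (T F p.1).2, fun p => (T G p.2).2, inferInstance, ?_, hwi.sub hi, ?_,
    (measurable_snd.comp hTF).comp measurable_fst, (measurable_snd.comp hTG).comp measurable_snd,
    (hF2.prod hG2).map_eq, fun q hq => ?_⟩
  · exact hw.sub ((((measurable_fst.comp hTF).comp measurable_fst).mul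
      ((measurable_fst.comp hTG).comp measurable_snd)).const_mul _)
  · rw [integral_sub hwi hi, hw0, hi0, sub_zero]
  · have h := hmain _ F G (hmeas hq) (hmeas hf) (hmeas hg) (by rw [hint hf, hf1])
      (by rw [hint hg, hg1])
    simp only [F, G, ratio_stdPDF_mul hab, hint hq, hdens hf, hdens hg] at h
    -- The regularity demanded by `GaussianRigid` holds because the tracked coordinate is N + ⟨v,X⟩.
    exact ⟨h.1, fun h1 h2 => h.2 h1 h2 (hasRegularDensity_map_add (by fun_prop))
      (hasRegularDensity_map_add (by fun_prop))⟩

/-! ### Entropy as an integral of the log-likelihood ratio -/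

section

variable {E : Type*} [MeasureSpace E] [SigmaFinite (volume : Measure E)]

theorem lintegral_ofReal_rnDeriv_mul {μ : Measure E} [IsProbabilityMeasure μ] (h : μ ≪ volume)
    {k : E → ℝ} (hk : Measurable k) :
    ∫⁻ x, ENNReal.ofReal ((μ.rnDeriv volume x).toReal * k x) = ∫⁻ x, ENNReal.ofReal (k x) ∂μ := by
  rw [← lintegral_rnDeriv_mul h hk.ennreal_ofReal.aemeasurable]
  refine lintegral_congr_ae ?_
  filter_upwards [Measure.rnDeriv_ne_top μ volume] with x hx
  rw [ENNReal.ofReal_mul ENNReal.toReal_nonneg, ENNReal.ofReal_toReal hx]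

/-- Writing the entropy as an integral against the law itself allows the entropies of several
vectors to be compared on one coupling space. -/
theorem lawEntropy_eq {μ : Measure E} [IsProbabilityMeasure μ] (h : μ ≪ volume) :
    lawEntropy μ = ((∫⁻ x, ENNReal.ofReal (-llr μ volume x) ∂μ : ℝ≥0∞) : EReal) -
      ((∫⁻ x, ENNReal.ofReal (llr μ volume x) ∂μ : ℝ≥0∞) : EReal) := by
  rw [lawEntropy, if_pos h, eintegral]
  have hm := measurable_llr μ volume
  congr 2
  · rw [← lintegral_ofReal_rnDeriv_mul h (show Measurable fun x => -llr μ volume x from hm.neg)]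
    refine lintegral_congr fun x => ?_
    rw [EReal.toENNReal_of_ne_top (EReal.coe_ne_top _), EReal.toReal_coe, Real.negMulLog]
    simp [llr]
  · rw [← lintegral_ofReal_rnDeriv_mul h hm]
    refine lintegral_congr fun x => ?_
    rw [← EReal.coe_neg, EReal.toENNReal_of_ne_top (EReal.coe_ne_top _), EReal.toReal_coe,
      Real.negMulLog]
    simp [llr]

end

theorem integrable_of_lintegral_ofReal_ne_top {α : Type*} [MeasurableSpace α] {μ : Measure α}
    {k : α → ℝ} (hk : AEStronglyMeasurable k μ) (h1 : ∫⁻ x, ENNReal.ofReal (-k x) ∂μ ≠ ∞)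
    (h2 : ∫⁻ x, ENNReal.ofReal (k x) ∂μ ≠ ∞) : Integrable k μ := by
  refine ⟨hk, ?_⟩
  have : ∀ x, ‖k x‖ₑ = ENNReal.ofReal (k x) + ENNReal.ofReal (-k x) := by
    intro x
    rw [Real.enorm_eq_ofReal_abs]
    rcases le_total 0 (k x) with h | h
    · rw [abs_of_nonneg h, ENNReal.ofReal_of_nonpos (neg_nonpos.2 h), add_zero]
    · rw [abs_of_nonpos h, ENNReal.ofReal_of_nonpos h, zero_add]
  rw [HasFiniteIntegral]
  simp_rw [this]
  rw [lintegral_add_left' hk.aemeasurable.ennreal_ofReal]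
  exact ENNReal.add_lt_top.2 ⟨h2.lt_top, h1.lt_top⟩

theorem lintegral_ofReal_ne_top {α : Type*} [MeasurableSpace α] {μ : Measure α}
    {k : α → ℝ} (hk : Integrable k μ) : ∫⁻ x, ENNReal.ofReal (k x) ∂μ ≠ ∞ :=
  (hk.lintegral_lt_top).ne

theorem coe_sub_coe_eq_integral {α : Type*} [MeasurableSpace α] {μ : Measure α}
    {k : α → ℝ} (hk : Integrable k μ) :
    ((∫⁻ x, ENNReal.ofReal (k x) ∂μ : ℝ≥0∞) : EReal) -
      ((∫⁻ x, ENNReal.ofReal (-k x) ∂μ : ℝ≥0∞) : EReal) = ((∫ x, k x ∂μ : ℝ) : EReal) := by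
  have h1 := lintegral_ofReal_ne_top hk
  have h2 : ∫⁻ x, ENNReal.ofReal (-k x) ∂μ ≠ ∞ := lintegral_ofReal_ne_top hk.neg
  rw [integral_eq_lintegral_pos_part_sub_lintegral_neg_part hk, EReal.coe_sub,
    EReal.coe_ennreal_toReal h1, EReal.coe_ennreal_toReal h2]

theorem lawEntropy_eq_integral {E : Type*} [MeasureSpace E] [SigmaFinite (volume : Measure E)]
    {μ : Measure E} [IsProbabilityMeasure μ] (h : μ ≪ volume)
    (hi : Integrable (llr μ volume) μ) :
    lawEntropy μ = ((-∫ x, llr μ volume x ∂μ : ℝ) : EReal) := by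
  have h1 := coe_sub_coe_eq_integral (k := fun x => -llr μ volume x) hi.neg
  rw [lawEntropy_eq h, ← integral_neg, ← h1]
  simp

theorem integrable_llr_of_lawEntropy_ne_bot {E : Type*} [MeasureSpace E]
    [SigmaFinite (volume : Measure E)] {μ : Measure E} [IsProbabilityMeasure μ]
    (h : μ ≪ volume) (h1 : ∫⁻ x, ENNReal.ofReal (-llr μ volume x) ∂μ ≠ ∞)
    (h2 : lawEntropy μ ≠ ⊥) : Integrable (llr μ volume) μ := by
  refine integrable_of_lintegral_ofReal_ne_top (measurable_llr _ _).aestronglyMeasurable h1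
    fun h3 => h2 ?_
  rw [lawEntropy_eq h, h3]
  simp

/-- The positive part of the entropy is controlled by the first moment. -/
theorem lintegral_neg_llr_le (E : Type*) [NormedAddCommGroup E] [NormedSpace ℝ E]
    [FiniteDimensional ℝ E] [MeasureSpace E] [BorelSpace E]
    [(volume : Measure E).IsAddHaarMeasure] :
    ∃ r C : ℝ≥0∞, r ≠ ∞ ∧ C ≠ ∞ ∧ ∀ μ : Measure E, IsProbabilityMeasure μ → μ ≪ volume →
      ∫⁻ x, ENNReal.ofReal (-llr μ volume x) ∂μ ≤ r * ∫⁻ x, ‖x‖ₑ ∂μ + C := by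
  -- With Q(x) = (1+‖x‖)^(-r), integrable for this r, one has -log f = log(Q/f) + r log(1+‖x‖) ≤ Q/f
  -- + r‖x‖, and the mean of Q/f is at most ∫ Q. The constants do not depend on the law, so the
  -- bound applies to all conditional laws at once.
  set r : ℝ := Module.finrank ℝ E + 1 with hr
  have hr0 : 0 < r := by positivity
  have hq : Integrable (fun x : E => (1 + ‖x‖) ^ (-r)) := integrable_one_add_norm (by simp [hr])
  refine ⟨ENNReal.ofReal r, ∫⁻ x : E, ENNReal.ofReal ((1 + ‖x‖) ^ (-r)), ENNReal.ofReal_ne_top,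
    lintegral_ofReal_ne_top hq, fun μ _ hac => ?_⟩
  have hm : Measurable fun x : E => (1 + ‖x‖) ^ (-r) := by fun_prop
  have hdiv : Measurable fun x : E => (1 + ‖x‖) ^ (-r) / (μ.rnDeriv volume x).toReal :=
    hm.div (Measure.measurable_rnDeriv μ volume).ennreal_toReal
  have key : ∀ᵐ x ∂μ, ENNReal.ofReal (-llr μ volume x) ≤ ENNReal.ofReal r * ‖x‖ₑ +
      ENNReal.ofReal ((1 + ‖x‖) ^ (-r) / (μ.rnDeriv volume x).toReal) := by
    filter_upwards [Measure.rnDeriv_pos hac, hac.ae_le (Measure.rnDeriv_ne_top μ volume)]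
      with x hx1 hx2
    have hF : 0 < (μ.rnDeriv volume x).toReal := ENNReal.toReal_pos hx1.ne' hx2
    have hn : 0 < 1 + ‖x‖ := by positivity
    have hQ : 0 < (1 + ‖x‖) ^ (-r) := Real.rpow_pos_of_pos hn _
    have h1 := Real.log_le_sub_one_of_pos (div_pos hQ hF)
    rw [Real.log_div hQ.ne' hF.ne', Real.log_rpow hn] at h1
    have h2 := Real.log_le_sub_one_of_pos hn
    rw [← ofReal_norm, ← ENNReal.ofReal_mul hr0.le, ← ENNReal.ofReal_add (by positivity)
      (by positivity)]
    refine ENNReal.ofReal_le_ofReal ?_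
    simp only [llr]
    nlinarith
  refine (lintegral_mono_ae key).trans ?_
  rw [lintegral_add_right _ hdiv.ennreal_ofReal, lintegral_const_mul _ measurable_enorm]
  refine add_le_add le_rfl ?_
  rw [← lintegral_ofReal_rnDeriv_mul hac hdiv]
  refine lintegral_mono fun x => ENNReal.ofReal_le_ofReal ?_
  by_cases h0 : (μ.rnDeriv volume x).toReal = 0
  · rw [h0, zero_mul]; positivity
  · rw [mul_div_cancel₀ _ h0]

/-! ### The entropy power inequality -/

section

variable {n : ℕ}

local notation "𝔼" => EuclideanSpace ℝ (Fin n)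

/-- The coupling bound with q the density of aX+bY. Almost surely all three densities are positive
and finite, so the quotient is the exponential of a combination of log-densities. -/
theorem exists_coupling_llr {a b : ℝ} (ha : 0 < a) (hb : 0 < b) (hab : a ^ 2 + b ^ 2 = 1)
    (v : 𝔼) {μ ν τ : Measure 𝔼} [IsProbabilityMeasure μ] [IsProbabilityMeasure ν]
    [IsProbabilityMeasure τ] (hμ : μ ≪ volume) (hν : ν ≪ volume) (hτ : τ ≪ volume)
    (h : (μ.prod ν).map (fun p => a • p.1 + b • p.2) = τ) :
    ∃ (Ω : Type) (_ : MeasurableSpace Ω) (ρ : Measure Ω) (w : Ω → ℝ) (X Y : Ω → 𝔼),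
      IsProbabilityMeasure ρ ∧ Integrable w ρ ∧ ∫ o, w o ∂ρ = 0 ∧
      MeasurePreserving (fun o => (X o, Y o)) ρ (μ.prod ν) ∧
      ∫⁻ o, ENNReal.ofReal (Real.exp (llr τ volume (a • X o + b • Y o) + w o -
        a ^ 2 * llr μ volume (X o) - b ^ 2 * llr ν volume (Y o))) ∂ρ ≤ 1 ∧
      ((∀ᵐ o ∂ρ, llr τ volume (a • X o + b • Y o) + w o -
        a ^ 2 * llr μ volume (X o) - b ^ 2 * llr ν volume (Y o) = 0) →
        ∃ m₁ m₂ s, smoothedMarginal μ v = gaussianReal m₁ s ∧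
          smoothedMarginal ν v = gaussianReal m₂ s) := by
  have hint : ∀ {μ : Measure 𝔼} [IsProbabilityMeasure μ], μ ≪ volume →
      ∫⁻ x, μ.rnDeriv volume x = 1 := fun {μ} _ hμ => by
    rw [Measure.lintegral_rnDeriv hμ, measure_univ]
  obtain ⟨Ω, mΩ, ρ, w, X, Y, hρ, hw, hwi, hw0, hX, hY, hXY, hmain⟩ := exists_coupling ha hb hab v
    (Measure.measurable_rnDeriv μ volume) (Measure.measurable_rnDeriv ν volume) (hint hμ) (hint hν)
  rw [Measure.withDensity_rnDeriv_eq _ _ hμ, Measure.withDensity_rnDeriv_eq _ _ hν] at hXY hmain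
  have hmp : MeasurePreserving (fun o => (X o, Y o)) ρ (μ.prod ν) := ⟨hX.prodMk hY, hXY⟩
  have hmp1 : MeasurePreserving X ρ μ := measurePreserving_fst.comp hmp
  have hmp2 : MeasurePreserving Y ρ ν := measurePreserving_snd.comp hmp
  have hmp3 : MeasurePreserving (fun o => a • X o + b • Y o) ρ τ :=
    (show MeasurePreserving (fun p : 𝔼 × 𝔼 => a • p.1 + b • p.2) (μ.prod ν) τ from
      ⟨by fun_prop, h⟩).comp hmp
  have hpos : ∀ {μ : Measure 𝔼} [IsProbabilityMeasure μ], μ ≪ volume →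
      ∀ᵐ x ∂μ, μ.rnDeriv volume x = ENNReal.ofReal (Real.exp (llr μ volume x)) := by
    intro μ _ hμ
    filter_upwards [exp_llr_of_ac μ volume hμ, hμ.ae_le (Measure.rnDeriv_ne_top μ volume)]
      with x hx1 hx2
    rw [hx1, ENNReal.ofReal_toReal hx2]
  have hratio : ∀ᵐ o ∂ρ, ratio a b (τ.rnDeriv volume) (μ.rnDeriv volume) (ν.rnDeriv volume)
      (w o) (X o) (Y o) = ENNReal.ofReal (Real.exp (llr τ volume (a • X o + b • Y o) + w o -
        a ^ 2 * llr μ volume (X o) - b ^ 2 * llr ν volume (Y o))) := by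
    filter_upwards [hmp1.quasiMeasurePreserving.ae (hpos hμ),
      hmp2.quasiMeasurePreserving.ae (hpos hν), hmp3.quasiMeasurePreserving.ae (hpos hτ)]
      with o h1 h2 h3
    rw [ratio, h1, h2, h3, ENNReal.ofReal_rpow_of_pos (Real.exp_pos _),
      ENNReal.ofReal_rpow_of_pos (Real.exp_pos _), ← ENNReal.ofReal_mul (Real.exp_pos _).le,
      ← ENNReal.ofReal_mul (by positivity), ← ENNReal.ofReal_mul (by positivity),
      ← Real.exp_mul, ← Real.exp_mul, ← Real.exp_add, ← Real.exp_add, ← Real.exp_add]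
    congr 2
    ring
  obtain ⟨hm1, hm2⟩ := hmain _ (Measure.measurable_rnDeriv τ volume)
  rw [hint hτ, lintegral_congr_ae hratio] at hm1
  refine ⟨Ω, mΩ, ρ, w, X, Y, hρ, hwi, hw0, hmp, hm1, fun h0 => hm2 (hint hτ).le ?_⟩
  filter_upwards [hratio, h0] with o h1 h2
  rw [h1, h2]
  simp

end

section

variable {n : ℕ}

local notation "𝔼" => EuclideanSpace ℝ (Fin n)

theorem integrable_exp_of_lintegral_le_one {Ω : Type*} [MeasurableSpace Ω] {ρ : Measure Ω}
    {k : Ω → ℝ} (hk : AEStronglyMeasurable k ρ)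
    (h : ∫⁻ o, ENNReal.ofReal (Real.exp (k o)) ∂ρ ≤ 1) :
    Integrable (fun o => Real.exp (k o)) ρ ∧ ∫ o, Real.exp (k o) ∂ρ ≤ 1 := by
  have hm : AEStronglyMeasurable (fun o => Real.exp (k o)) ρ :=
    Real.continuous_exp.comp_aestronglyMeasurable hk
  have h0 : 0 ≤ᵐ[ρ] fun o => Real.exp (k o) := ae_of_all _ fun o => (Real.exp_pos _).le
  constructor
  · refine ⟨hm, ?_⟩
    rw [hasFiniteIntegral_iff_ofReal h0]
    exact h.trans_lt ENNReal.one_lt_top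
  · rw [integral_eq_lintegral_of_nonneg_ae h0 hm]
    exact ENNReal.toReal_le_of_le_ofReal zero_le_one (by simpa using h)

/-- Integrate e^k ≥ 1 + k, where equality holds only at k = 0. -/
theorem integral_nonpos_of_lintegral_exp_le_one {Ω : Type*} [MeasurableSpace Ω] {ρ : Measure Ω}
    [IsProbabilityMeasure ρ] {k : Ω → ℝ} (hk : Integrable k ρ)
    (h : ∫⁻ o, ENNReal.ofReal (Real.exp (k o)) ∂ρ ≤ 1) :
    ∫ o, k o ∂ρ ≤ 0 ∧ (∫ o, k o ∂ρ = 0 → ∀ᵐ o ∂ρ, k o = 0) := by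
  obtain ⟨he, he1⟩ := integrable_exp_of_lintegral_le_one hk.aestronglyMeasurable h
  have hnn : ∀ o, 0 ≤ Real.exp (k o) - k o - 1 := fun o => by
    linarith [Real.add_one_le_exp (k o)]
  have hd : Integrable (fun o => Real.exp (k o) - k o) ρ := he.sub hk
  have hi : Integrable (fun o => Real.exp (k o) - k o - 1) ρ := hd.sub (integrable_const 1)
  have hI : ∫ o, (Real.exp (k o) - k o - 1) ∂ρ = ∫ o, Real.exp (k o) ∂ρ - ∫ o, k o ∂ρ - 1 := by
    rw [integral_sub hd (integrable_const 1), integral_sub he hk]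
    simp
  have hI0 := integral_nonneg (μ := ρ) (f := fun o => Real.exp (k o) - k o - 1) hnn
  refine ⟨by linarith, fun h0 => ?_⟩
  have h1 := (integral_eq_zero_iff_of_nonneg hnn hi).1 (by linarith)
  filter_upwards [h1] with o ho
  by_contra hne
  have := Real.add_one_lt_exp hne
  simp only [Pi.zero_apply] at ho
  linarith

theorem lintegral_ofReal_ne_top_of_le {Ω : Type*} [MeasurableSpace Ω] {ρ : Measure Ω}
    {k k' : Ω → ℝ} (hk' : Integrable k' ρ) (h : ∀ o, k o ≤ k' o) :
    ∫⁻ o, ENNReal.ofReal (k o) ∂ρ ≠ ∞ :=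
  ((lintegral_mono fun o => ENNReal.ofReal_le_ofReal (h o)).trans_lt
    (lintegral_ofReal_ne_top hk').lt_top).ne

/-- The entropy power inequality with its equality case. -/
theorem entropy_power {a b : ℝ} (ha : 0 < a) (hb : 0 < b) (hab : a ^ 2 + b ^ 2 = 1)
    {μ ν τ : Measure 𝔼} [IsProbabilityMeasure μ] [IsProbabilityMeasure ν]
    [IsProbabilityMeasure τ] (hμ : μ ≪ volume) (hν : ν ≪ volume) (hτ : τ ≪ volume)
    (h : (μ.prod ν).map (fun p => a • p.1 + b • p.2) = τ)
    (hμi : Integrable (llr μ volume) μ) (hνi : Integrable (llr ν volume) ν)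
    (hτi : ∫⁻ x, ENNReal.ofReal (-llr τ volume x) ∂τ ≠ ∞) :
    Integrable (llr τ volume) τ ∧
      ∫ x, llr τ volume x ∂τ ≤ a ^ 2 * ∫ x, llr μ volume x ∂μ + b ^ 2 * ∫ x, llr ν volume x ∂ν ∧
      (∫ x, llr τ volume x ∂τ = a ^ 2 * ∫ x, llr μ volume x ∂μ + b ^ 2 * ∫ x, llr ν volume x ∂ν →
        ∀ v, ∃ m₁ m₂ s, smoothedMarginal μ v = gaussianReal m₁ s ∧
          smoothedMarginal ν v = gaussianReal m₂ s) := by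
  -- The coupling depends on v, so everything is proved for each v; the first two conclusions do not
  -- involve v and are read off at v = 0.
  have key : ∀ v : 𝔼, Integrable (llr τ volume) τ ∧
      ∫ x, llr τ volume x ∂τ ≤ a ^ 2 * ∫ x, llr μ volume x ∂μ + b ^ 2 * ∫ x, llr ν volume x ∂ν ∧
      (∫ x, llr τ volume x ∂τ = a ^ 2 * ∫ x, llr μ volume x ∂μ + b ^ 2 * ∫ x, llr ν volume x ∂ν →
        ∃ m₁ m₂ s, smoothedMarginal μ v = gaussianReal m₁ s ∧
          smoothedMarginal ν v = gaussianReal m₂ s) := by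
    intro v
    obtain ⟨Ω, mΩ, ρ, w, X, Y, hρ, hwi, hw0, hXY, hexp, heq⟩ :=
      exists_coupling_llr ha hb hab v hμ hν hτ h
    have hX : MeasurePreserving X ρ μ := measurePreserving_fst.comp hXY
    have hY : MeasurePreserving Y ρ ν := measurePreserving_snd.comp hXY
    have hZ : MeasurePreserving (fun o => a • X o + b • Y o) ρ τ :=
      (show MeasurePreserving (fun p : 𝔼 × 𝔼 => a • p.1 + b • p.2) (μ.prod ν) τ from
        ⟨by fun_prop, h⟩).comp hXY
    have hμX : Integrable (fun o => llr μ volume (X o)) ρ := hX.integrable_comp_of_integrable hμi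
    have hνY : Integrable (fun o => llr ν volume (Y o)) ρ := hY.integrable_comp_of_integrable hνi
    have hZm : AEStronglyMeasurable (fun o => llr τ volume (a • X o + b • Y o)) ρ :=
      ((measurable_llr _ _).comp hZ.measurable).aestronglyMeasurable
    have he := (integrable_exp_of_lintegral_le_one
      (((hZm.add hwi.1).sub (hμX.const_mul (a ^ 2)).1).sub (hνY.const_mul (b ^ 2)).1) hexp).1
    -- The negative part is controlled by hypothesis; the positive part by solving k ≤ e^k - 1 for
    -- the log-density of aX+bY.
    have hτZ : Integrable (fun o => llr τ volume (a • X o + b • Y o)) ρ := by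
      refine integrable_of_lintegral_ofReal_ne_top hZm ?_ ?_
      · rwa [hZ.lintegral_comp (f := fun x => ENNReal.ofReal (-llr τ volume x))
          (measurable_llr _ _).neg.ennreal_ofReal]
      · refine lintegral_ofReal_ne_top_of_le
          (((he.sub hwi).add (hμX.const_mul (a ^ 2))).add (hνY.const_mul (b ^ 2))) fun o => ?_
        simp only [Pi.add_apply, Pi.sub_apply]
        linarith [Real.add_one_le_exp (llr τ volume (a • X o + b • Y o) + w o -
          a ^ 2 * llr μ volume (X o) - b ^ 2 * llr ν volume (Y o))]
    have hτi' : Integrable (llr τ volume) τ := by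
      rw [← hZ.map_eq]
      refine (integrable_map_measure ?_ hZ.measurable.aemeasurable).2 ?_
      · exact (measurable_llr _ _).aestronglyMeasurable
      · simp only [hZ.map_eq]
        exact hτZ
    have i1 : ∫ o, llr μ volume (X o) ∂ρ = ∫ x, llr μ volume x ∂μ := by
      have := integral_map (μ := ρ) hX.measurable.aemeasurable
        (f := llr μ volume) (measurable_llr _ _).aestronglyMeasurable
      rw [← this, hX.map_eq]
    have i2 : ∫ o, llr ν volume (Y o) ∂ρ = ∫ x, llr ν volume x ∂ν := by
      have := integral_map (μ := ρ) hY.measurable.aemeasurable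
        (f := llr ν volume) (measurable_llr _ _).aestronglyMeasurable
      rw [← this, hY.map_eq]
    have i3 : ∫ o, llr τ volume (a • X o + b • Y o) ∂ρ = ∫ x, llr τ volume x ∂τ := by
      have := integral_map (μ := ρ) hZ.measurable.aemeasurable
        (f := llr τ volume) (measurable_llr _ _).aestronglyMeasurable
      rw [← this, hZ.map_eq]
    have hI : ∫ o, (llr τ volume (a • X o + b • Y o) + w o -
        a ^ 2 * llr μ volume (X o) - b ^ 2 * llr ν volume (Y o)) ∂ρ =
        ∫ x, llr τ volume x ∂τ - a ^ 2 * ∫ x, llr μ volume x ∂μ -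
          b ^ 2 * ∫ x, llr ν volume x ∂ν := by
      have t1 : Integrable (fun o => llr τ volume (a • X o + b • Y o) + w o) ρ := hτZ.add hwi
      have t2 : Integrable (fun o => llr τ volume (a • X o + b • Y o) + w o -
        a ^ 2 * llr μ volume (X o)) ρ := t1.sub (hμX.const_mul (a ^ 2))
      rw [integral_sub t2 (hνY.const_mul (b ^ 2)),
        integral_sub t1 (hμX.const_mul (a ^ 2)), integral_add hτZ hwi,
        integral_const_mul, integral_const_mul, i1, i2, i3, hw0, add_zero]
    obtain ⟨hle, h0⟩ := integral_nonpos_of_lintegral_exp_le_one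
      (((hτZ.add hwi).sub (hμX.const_mul (a ^ 2))).sub (hνY.const_mul (b ^ 2))) hexp
    simp only [Pi.add_apply, Pi.sub_apply] at hle h0
    rw [hI] at hle h0
    exact ⟨hτi', by linarith, fun h1 => heq (h0 (by linarith))⟩
  exact ⟨(key 0).1, (key 0).2.1, fun h v => (key v).2.2 h⟩

/-- If the conditional entropy is not `-∞`, neither are the entropies of the two vectors. -/
theorem integrable_llr_of_lintegral_cond {a b : ℝ} (ha : 0 < a) (hb : 0 < b)
    (hab : a ^ 2 + b ^ 2 = 1)
    {μ ν τ : Measure 𝔼} [IsProbabilityMeasure μ] [IsProbabilityMeasure ν]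
    [IsProbabilityMeasure τ] (hμ : μ ≪ volume) (hν : ν ≪ volume) (hτ : τ ≪ volume)
    (h : (μ.prod ν).map (fun p => a • p.1 + b • p.2) = τ)
    (hμi : ∫⁻ x, ENNReal.ofReal (-llr μ volume x) ∂μ ≠ ∞)
    (hνi : ∫⁻ x, ENNReal.ofReal (-llr ν volume x) ∂ν ≠ ∞)
    (hc : ∫⁻ p, ENNReal.ofReal (llr μ volume p.1 + llr ν volume p.2 -
      llr τ volume (a • p.1 + b • p.2)) ∂(μ.prod ν) ≠ ∞) :
    Integrable (llr μ volume) μ ∧ Integrable (llr ν volume) ν := by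
  obtain ⟨Ω, mΩ, ρ, w, X, Y, hρ, hwi, -, hXY, hexp, -⟩ :=
    exists_coupling_llr ha hb hab 0 hμ hν hτ h
  have hX : MeasurePreserving X ρ μ := measurePreserving_fst.comp hXY
  have hY : MeasurePreserving Y ρ ν := measurePreserving_snd.comp hXY
  have hμm := measurable_llr μ (volume : Measure 𝔼)
  have hνm := measurable_llr ν (volume : Measure 𝔼)
  have hτm := measurable_llr τ (volume : Measure 𝔼)
  have hXm := hX.measurable
  have hYm := hY.measurable
  have hμX : Measurable fun o => llr μ volume (X o) := hμm.comp hXm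
  have hνY : Measurable fun o => llr ν volume (Y o) := hνm.comp hYm
  have hτZ : Measurable fun o => llr τ volume (a • X o + b • Y o) :=
    hτm.comp ((hXm.const_smul a).add (hYm.const_smul b))
  rw [← hX.lintegral_comp (f := fun x => ENNReal.ofReal (-llr μ volume x))
    hμm.neg.ennreal_ofReal] at hμi
  rw [← hY.lintegral_comp (f := fun x => ENNReal.ofReal (-llr ν volume x))
    hνm.neg.ennreal_ofReal] at hνi
  rw [← hXY.lintegral_comp (f := fun p : 𝔼 × 𝔼 => ENNReal.ofReal (llr μ volume p.1 +
    llr ν volume p.2 - llr τ volume (a • p.1 + b • p.2))) (by fun_prop)] at hc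
  have he := (integrable_exp_of_lintegral_le_one (ρ := ρ) (((hτZ.aestronglyMeasurable.add hwi.1).sub
    (hμX.const_mul (a ^ 2)).aestronglyMeasurable).sub
    (hνY.const_mul (b ^ 2)).aestronglyMeasurable) hexp).1
  have hpp : ∀ {k : Ω → ℝ}, Measurable k → ∫⁻ o, ENNReal.ofReal (k o) ∂ρ ≠ ∞ →
      Integrable (fun o => max (k o) 0) ρ := by
    intro k hk hfin
    refine integrable_of_lintegral_ofReal_ne_top (hk.max measurable_const).aestronglyMeasurable
      ?_ ?_
    · have : ∀ o, ENNReal.ofReal (-max (k o) 0) = 0 := fun o =>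
        ENNReal.ofReal_of_nonpos (by simp)
      simp [this]
    · simpa [ENNReal.ofReal_max] using hfin
  have i1 := hpp (hμX.neg) hμi
  have i2 := hpp (hνY.neg) hνi
  have i3 := hpp ((hμX.add hνY).sub hτZ) hc
  simp only [Pi.add_apply, Pi.sub_apply, Pi.neg_apply] at i1 i2 i3
  have ha2 : 0 < a ^ 2 := by positivity
  have hb2 : 0 < b ^ 2 := by positivity
  -- Adding k ≤ e^k - 1 to the trivial bound by the positive part eliminates the log-density of
  -- aX+bY. The combination left has positive weights b² and a², and the negative parts of both
  -- log-densities are integrable, so each positive part is integrable too.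
  have hbound : ∀ o, b ^ 2 * llr μ volume (X o) + a ^ 2 * llr ν volume (Y o) ≤
      max (llr μ volume (X o) + llr ν volume (Y o) - llr τ volume (a • X o + b • Y o)) 0 +
        (Real.exp (llr τ volume (a • X o + b • Y o) + w o - a ^ 2 * llr μ volume (X o) -
          b ^ 2 * llr ν volume (Y o)) - w o) := by
    intro o
    have h1 := Real.add_one_le_exp (llr τ volume (a • X o + b • Y o) + w o -
      a ^ 2 * llr μ volume (X o) - b ^ 2 * llr ν volume (Y o))
    have h2 := le_max_left (llr μ volume (X o) + llr ν volume (Y o) -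
      llr τ volume (a • X o + b • Y o)) 0
    have h3 : b ^ 2 * llr μ volume (X o) + a ^ 2 * llr ν volume (Y o) =
        llr μ volume (X o) + llr ν volume (Y o) - a ^ 2 * llr μ volume (X o) -
          b ^ 2 * llr ν volume (Y o) := by
      linear_combination (llr μ volume (X o) + llr ν volume (Y o)) * hab
    linarith
  have hj := i3.add (he.sub hwi)
  constructor
  · have hfin : Integrable (fun o => llr μ volume (X o)) ρ := by
      refine integrable_of_lintegral_ofReal_ne_top hμX.aestronglyMeasurable hμi
        (lintegral_ofReal_ne_top_of_le ((hj.add (i2.const_mul (a ^ 2))).div_const (b ^ 2))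
        fun o => ?_)
      rw [le_div_iff₀ hb2]
      have h1 := hbound o
      have h2 := mul_le_mul_of_nonneg_left (le_max_left (-llr ν volume (Y o)) 0) ha2.le
      simp only [Pi.add_apply, Pi.sub_apply]
      linarith
    have := (integrable_map_measure (f := X) (μ := ρ) (g := llr μ volume)
      hμm.aestronglyMeasurable hXm.aemeasurable).2 hfin
    rwa [hX.map_eq] at this
  · have hfin : Integrable (fun o => llr ν volume (Y o)) ρ := by
      refine integrable_of_lintegral_ofReal_ne_top hνY.aestronglyMeasurable hνi
        (lintegral_ofReal_ne_top_of_le ((hj.add (i1.const_mul (b ^ 2))).div_const (a ^ 2))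
        fun o => ?_)
      rw [le_div_iff₀ ha2]
      have h1 := hbound o
      have h2 := mul_le_mul_of_nonneg_left (le_max_left (-llr μ volume (X o)) 0) hb2.le
      simp only [Pi.add_apply, Pi.sub_apply]
      linarith
    have := (integrable_map_measure (f := Y) (μ := ρ) (g := llr ν volume)
      hνm.aestronglyMeasurable hYm.aemeasurable).2 hfin
    rwa [hY.map_eq] at this

end

/-! ### Conditional entropy -/

section

variable {E F : Type*} [MeasureSpace E] [SigmaFinite (volume : Measure E)]
  [MeasureSpace F] [SigmaFinite (volume : Measure F)]

theorem ae_eq_marg_mul_div {f : E × F → ℝ≥0∞} (hf : Measurable f) (h1 : ∫⁻ p, f p ≠ ∞) :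
    ∀ᵐ p : E × F, f p = marg f p.1 * (f p / marg f p.1) := by
  have hm := measurable_marg hf
  have hm' : Measurable fun p : E × F => marg f p.1 := hm.comp measurable_fst
  rw [Measure.volume_eq_prod]
  refine Measure.ae_prod_mem_iff_ae_ae_mem (s := {p | f p = marg f p.1 * (f p / marg f p.1)})
    (measurableSet_eq_fun hf (hm'.mul (hf.div hm'))) |>.2 ?_
  have hfin : ∀ᵐ x, marg f x < ∞ := by
    refine ae_lt_top hm ?_
    rwa [lintegral_marg hf]
  filter_upwards [hfin] with x hx
  by_cases h0 : marg f x = 0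
  · have := (lintegral_eq_zero_iff (hf.comp (measurable_const.prodMk measurable_id))).1 h0
    filter_upwards [this] with s hs
    simpa [h0] using hs
  · refine ae_of_all _ fun s => ?_
    show f (x, s) = marg f x * (f (x, s) / marg f x)
    rw [ENNReal.mul_div_cancel h0 hx.ne]

variable [MeasurableSpace.CountableOrCountablyGenerated E F]
  {π : Measure (E × F)} [IsProbabilityMeasure π] {τ : Measure E} [IsProbabilityMeasure τ]
  {κ : Kernel E F} [IsMarkovKernel κ]

/-- Uniqueness of disintegration: the kernel with density p / marg p has the same composition
product with τ. -/
theorem ae_kernel_eq_withDensity {p : E × F → ℝ≥0∞} (hp : Measurable p)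
    (hπ : π = volume.withDensity p) (hκ : π = τ ⊗ₘ κ) :
    ∀ᵐ v ∂τ, κ v = volume.withDensity fun u => p (v, u) / marg p v := by
  have hm := measurable_marg hp
  have hm' : Measurable fun z : E × F => marg p z.1 := hm.comp measurable_fst
  have hk : Measurable fun z : E × F => p z / marg p z.1 := hp.div hm'
  have hτ : τ = volume.withDensity (marg p) := by
    rw [← map_fst_withDensity hp, ← hπ, hκ]
    exact (Measure.fst_compProd τ κ).symm
  have hp1 : ∫⁻ z, p z ≠ ∞ := by
    have : π univ = ∫⁻ z, p z := by
      rw [hπ, withDensity_apply _ MeasurableSet.univ, setLIntegral_univ]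
    rw [← this]
    exact measure_ne_top _ _
  set η : Kernel E F := (Kernel.const E (volume : Measure F)).withDensity
    fun v u => p (v, u) / marg p v with hη
  have hηv : ∀ v, η v = volume.withDensity fun u => p (v, u) / marg p v := fun v => by
    rw [hη, Kernel.withDensity_apply _ hk, Kernel.const_apply]
  -- The quotient has total mass at most 1 for every v, including those where the marginal density
  -- is 0 or ∞.
  have : IsFiniteKernel η := by
    refine ⟨1, ENNReal.one_lt_top, fun v => ?_⟩
    rw [hηv, withDensity_apply _ MeasurableSet.univ, setLIntegral_univ]
    simp_rw [div_eq_mul_inv]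
    rw [lintegral_mul_const _ (show Measurable fun u => p (v, u) from
      hp.comp (measurable_const.prodMk measurable_id)), ← div_eq_mul_inv]
    exact ENNReal.div_self_le_one
  have heq : τ ⊗ₘ κ = τ ⊗ₘ η := by
    have h1 : τ ⊗ₘ η = (τ.prod volume).withDensity fun z => p z / marg p z.1 := by
      rw [hη, Measure.compProd_withDensity hk, Measure.compProd_const]
    rw [h1, ← hκ, hπ, hτ, prod_withDensity_left hm,
      ← withDensity_mul _ hm' hk, ← Measure.volume_eq_prod]
    exact withDensity_congr_ae (ae_eq_marg_mul_div hp hp1)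
  filter_upwards [Kernel.ae_eq_of_compProd_eq heq] with v hv
  rw [hv, hηv]

/-- The chain rule log p(u|v) = log p(v,u) - log p(v), valid where the densities are positive and
finite. -/
theorem ae_llr_kernel (hac : π ≪ volume) (hκ : π = τ ⊗ₘ κ) :
    ∀ᵐ v ∂τ, κ v ≪ volume ∧
      ∀ᵐ u ∂(κ v), llr (κ v) volume u = llr π volume (v, u) - llr τ volume v := by
  have hp := Measure.measurable_rnDeriv π volume
  have hπ := (Measure.withDensity_rnDeriv_eq _ _ hac).symm
  have hτ : τ = volume.withDensity (marg (π.rnDeriv volume)) := by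
    rw [← map_fst_withDensity hp, ← hπ, hκ]
    exact (Measure.fst_compProd τ κ).symm
  have hm := measurable_marg hp
  have hτac : τ ≪ volume := hτ ▸ withDensity_absolutelyContinuous _ _
  have hτd : ∀ᵐ v ∂τ, τ.rnDeriv volume v = marg (π.rnDeriv volume) v := by
    refine hτac.ae_le ?_
    have := Measure.rnDeriv_withDensity volume hm
    rwa [← hτ] at this
  have hpos : ∀ᵐ v ∂τ, ∀ᵐ u ∂(κ v), 0 < π.rnDeriv volume (v, u) ∧ π.rnDeriv volume (v, u) < ∞ := by
    refine Measure.ae_ae_of_ae_compProd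
      (p := fun z => 0 < π.rnDeriv volume z ∧ π.rnDeriv volume z < ∞) ?_
    rw [← hκ]
    filter_upwards [Measure.rnDeriv_pos hac, hac.ae_le (Measure.rnDeriv_lt_top π volume)]
      with z h1 h2 using ⟨h1, h2⟩
  filter_upwards [ae_kernel_eq_withDensity hp hπ hκ, hτd, hpos, Measure.rnDeriv_pos hτac,
    hτac.ae_le (Measure.rnDeriv_lt_top τ volume)] with v hv h1 h2 h3 h4
  have hac' : κ v ≪ volume := by rw [hv]; exact withDensity_absolutelyContinuous _ _
  refine ⟨hac', ?_⟩
  have hd : Measurable fun u => π.rnDeriv volume (v, u) / marg (π.rnDeriv volume) v :=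
    (hp.comp (measurable_const.prodMk measurable_id)).div measurable_const
  have h5 := Measure.rnDeriv_withDensity volume hd
  rw [← hv] at h5
  filter_upwards [hac'.ae_le h5, h2] with u hu1 hu2
  rw [llr, hu1, ← h1, ENNReal.toReal_div, Real.log_div]
  · rfl
  · exact (ENNReal.toReal_pos hu2.1.ne' hu2.2.ne).ne'
  · exact (ENNReal.toReal_pos h3.ne' h4.ne).ne'

omit [SigmaFinite (volume : Measure E)] [SigmaFinite (volume : Measure F)]
  [MeasurableSpace.CountableOrCountablyGenerated E F] [IsProbabilityMeasure π]
  [IsProbabilityMeasure τ] [IsMarkovKernel κ] in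
theorem measurable_llr_sub : Measurable fun z : E × F => llr π volume z - llr τ volume z.1 :=
  (measurable_llr _ _).sub ((measurable_llr _ _).comp measurable_fst)

theorem eintegral_congr {α : Type*} [MeasurableSpace α] {μ : Measure α} {g g' : α → EReal}
    (h : g =ᵐ[μ] g') : eintegral μ g = eintegral μ g' := by
  rw [eintegral, eintegral]
  congr 2
  · exact lintegral_congr_ae (h.mono fun x hx => by simp only [hx])
  · exact lintegral_congr_ae (h.mono fun x hx => by simp only [hx])

theorem eintegral_coe {α : Type*} [MeasurableSpace α] {μ : Measure α} {k : α → ℝ}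
    (hk : Integrable k μ) : eintegral μ (fun x => (k x : EReal)) = ((∫ x, k x ∂μ : ℝ) : EReal) := by
  rw [eintegral, ← coe_sub_coe_eq_integral hk]
  congr 2

theorem eintegral_lawEntropy_eq (hac : π ≪ volume) (hκ : π = τ ⊗ₘ κ)
    (hi : Integrable (fun z => llr π volume z - llr τ volume z.1) π) :
    eintegral τ (fun v => lawEntropy (κ v)) =
      ((-∫ z, (llr π volume z - llr τ volume z.1) ∂π : ℝ) : EReal) := by
  have hi' : Integrable (fun z => llr π volume z - llr τ volume z.1) (τ ⊗ₘ κ) := by rwa [← hκ]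
  have h1 := ((Measure.integrable_compProd_iff hi'.1).1 hi').1
  have h2 : (fun v => lawEntropy (κ v)) =ᵐ[τ]
      fun v => ((-∫ u, (llr π volume (v, u) - llr τ volume v) ∂(κ v) : ℝ) : EReal) := by
    filter_upwards [h1, ae_llr_kernel hac hκ] with v hv1 hv2
    rw [lawEntropy_eq_integral hv2.1 ((integrable_congr hv2.2).2 hv1), integral_congr_ae hv2.2]
  have h3 : Integrable (fun v => ∫ u, (llr π volume (v, u) - llr τ volume v) ∂(κ v)) τ :=
    Integrable.integral_compProd (κ := Kernel.const Unit τ) (η := Kernel.prodMkLeft Unit κ)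
      (a := ()) hi'
  have h4 := eintegral_coe (k := fun v => -∫ u, (llr π volume (v, u) - llr τ volume v) ∂(κ v))
    h3.neg
  have h5 : ∫ z, (llr π volume z - llr τ volume z.1) ∂π =
      ∫ z, (llr π volume z - llr τ volume z.1) ∂(τ ⊗ₘ κ) := by rw [← hκ]
  rw [eintegral_congr h2, h4, integral_neg, h5, Measure.integral_compProd hi']

/-- Bounds the negative part of an entropy by its positive part together with the negative part of
its extended value. -/
theorem le_add_toENNReal_neg_sub (p q : ℝ≥0∞) :
    q ≤ p + (-((p : EReal) - (q : EReal))).toENNReal := by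
  by_cases hp : p = ∞
  · simp [hp]
  by_cases hq : q = ∞
  · rw [hq]
    simp
  lift p to NNReal using hp
  lift q to NNReal using hq
  have : (-(((p : ℝ≥0∞) : EReal) - ((q : ℝ≥0∞) : EReal))) = (((q : ℝ) - p : ℝ) : EReal) := by
    rw [show ((p : ℝ≥0∞) : EReal) = ((p : ℝ) : EReal) from rfl,
      show ((q : ℝ≥0∞) : EReal) = ((q : ℝ) : EReal) from rfl, ← EReal.coe_sub, ← EReal.coe_neg]
    congr 1
    ring
  rw [this, EReal.toENNReal_of_ne_top (EReal.coe_ne_top _), EReal.toReal_coe,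
    ENNReal.ofReal_sub _ p.coe_nonneg, ENNReal.ofReal_coe_nnreal, ENNReal.ofReal_coe_nnreal]
  exact le_add_tsub

end

/-- The positive part of each conditional entropy integral is bounded by the conditional first
moment, uniformly in the law, and these bounds have finite mean. A conditional entropy other than
`⊥` then leaves only a finite negative contribution. -/
theorem lintegral_llr_kernel_ne_top {E F : Type*} [MeasureSpace E]
    [SigmaFinite (volume : Measure E)] [NormedAddCommGroup F]
    [NormedSpace ℝ F] [FiniteDimensional ℝ F] [MeasureSpace F] [BorelSpace F]
    [(volume : Measure F).IsAddHaarMeasure]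
    {π : Measure (E × F)} [IsProbabilityMeasure π] {τ : Measure E} [IsProbabilityMeasure τ]
    {κ : Kernel E F} [IsMarkovKernel κ] (hac : π ≪ volume) (hκ : π = τ ⊗ₘ κ)
    (hmom : ∫⁻ z, ‖z.2‖ₑ ∂π ≠ ∞) (h : eintegral τ (fun v => lawEntropy (κ v)) ≠ ⊥) :
    ∫⁻ z, ENNReal.ofReal (llr π volume z - llr τ volume z.1) ∂π ≠ ∞ := by
  have : ProperSpace F := FiniteDimensional.proper ℝ F
  -- In `EReal` subtracting `⊤` always gives `⊥`, even from `⊤`, so the negative part must be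
  -- finite.
  have hN : ∫⁻ v, (-lawEntropy (κ v)).toENNReal ∂τ ≠ ∞ := fun h1 => h (by
    rw [eintegral, h1]; simp)
  obtain ⟨r, C, hr, hC, hrC⟩ := lintegral_neg_llr_le F
  have hmm : Measurable fun v => ∫⁻ u, ‖u‖ₑ ∂(κ v) := measurable_enorm.lintegral_kernel
  have hK := measurable_llr_sub (π := π) (τ := τ)
  have hle : ∀ᵐ v ∂τ, ∫⁻ u, ENNReal.ofReal (llr π volume (v, u) - llr τ volume v) ∂(κ v) ≤
      (r * ∫⁻ u, ‖u‖ₑ ∂(κ v) + C) + (-lawEntropy (κ v)).toENNReal := by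
    filter_upwards [ae_llr_kernel hac hκ] with v hv
    have h1 := le_add_toENNReal_neg_sub (∫⁻ u, ENNReal.ofReal (-llr (κ v) volume u) ∂(κ v))
      (∫⁻ u, ENNReal.ofReal (llr (κ v) volume u) ∂(κ v))
    rw [← lawEntropy_eq hv.1] at h1
    have h2 : ∫⁻ u, ENNReal.ofReal (llr (κ v) volume u) ∂(κ v) =
        ∫⁻ u, ENNReal.ofReal (llr π volume (v, u) - llr τ volume v) ∂(κ v) :=
      lintegral_congr_ae (hv.2.mono fun u hu => by simp only [hu])
    rw [← h2]
    exact h1.trans (add_le_add (hrC (κ v) inferInstance hv.1) le_rfl)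
  have hmom' : ∫⁻ z, ‖z.2‖ₑ ∂π = ∫⁻ v, ∫⁻ u, ‖u‖ₑ ∂(κ v) ∂τ := by
    rw [hκ, Measure.lintegral_compProd (f := fun z : E × F => ‖z.2‖ₑ) (by fun_prop)]
  have h3 : ∫⁻ z, ENNReal.ofReal (llr π volume z - llr τ volume z.1) ∂π =
      ∫⁻ v, ∫⁻ u, ENNReal.ofReal (llr π volume (v, u) - llr τ volume v) ∂(κ v) ∂τ := by
    conv_lhs => rw [hκ]
    rw [Measure.lintegral_compProd (f := fun z : E × F => ENNReal.ofReal (llr (τ ⊗ₘ κ) volume z -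
      llr τ volume z.1)) measurable_llr_sub.ennreal_ofReal]
    simp only [← hκ]
  rw [h3]
  refine ((lintegral_mono_ae hle).trans_lt ?_).ne
  rw [lintegral_add_left ((hmm.const_mul r).add_const C), lintegral_add_right _ measurable_const,
    lintegral_const_mul _ hmm, ← hmom', lintegral_const, measure_univ, mul_one]
  exact ENNReal.add_lt_top.2 ⟨ENNReal.add_lt_top.2 ⟨ENNReal.mul_lt_top hr.lt_top hmom.lt_top,
    hC.lt_top⟩, hN.lt_top⟩

/-! ### Log-likelihood ratios of products, images and joint laws -/

theorem rnDeriv_mem_Ioo {α : Type*} [MeasurableSpace α] {μ κ : Measure α} [SigmaFinite μ]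
    [SigmaFinite κ] (h : μ ≪ κ) : ∀ᵐ x ∂μ, 0 < μ.rnDeriv κ x ∧ μ.rnDeriv κ x < ∞ := by
  filter_upwards [Measure.rnDeriv_pos h, h.ae_le (Measure.rnDeriv_lt_top μ κ)] with x h1 h2
    using ⟨h1, h2⟩

theorem absolutelyContinuous_of_rnDeriv_ne_zero {α : Type*} [MeasurableSpace α]
    {μ ν κ : Measure α} [SigmaFinite ν] [SigmaFinite κ] (hμ : μ ≪ κ) (hν : ν ≪ κ)
    (h : ∀ᵐ x ∂μ, ν.rnDeriv κ x ≠ 0) : μ ≪ ν := by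
  refine Measure.AbsolutelyContinuous.mk fun s hs h0 => ?_
  rw [← Measure.withDensity_rnDeriv_eq _ _ hν,
    withDensity_apply_eq_zero (Measure.measurable_rnDeriv _ _)] at h0
  refine measure_mono_null (t := ({x | ν.rnDeriv κ x ≠ 0} ∩ s) ∪ {x | ¬ ν.rnDeriv κ x ≠ 0}) ?_
    (measure_union_null (hμ h0) h)
  intro x hx
  by_cases h1 : ν.rnDeriv κ x ≠ 0
  · exact Or.inl ⟨h1, hx⟩
  · exact Or.inr h1

theorem llr_eq_sub {α : Type*} [MeasurableSpace α] {μ ν κ : Measure α} [SigmaFinite μ]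
    [SigmaFinite ν] [SigmaFinite κ] (hμν : μ ≪ ν) (hν : ν ≪ κ) :
    ∀ᵐ x ∂μ, llr μ ν x = llr μ κ x - llr ν κ x := by
  have hμ := hμν.trans hν
  filter_upwards [hμ.ae_le (Measure.rnDeriv_mul_rnDeriv hμν (κ := κ)), rnDeriv_mem_Ioo hμν,
    hμν.ae_le (rnDeriv_mem_Ioo hν)] with x h1 h2 h3
  rw [llr, llr, llr, ← h1, Pi.mul_apply, ENNReal.toReal_mul, Real.log_mul, add_sub_cancel_right]
  · exact (ENNReal.toReal_pos h2.1.ne' h2.2.ne).ne'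
  · exact (ENNReal.toReal_pos h3.1.ne' h3.2.ne).ne'

theorem rnDeriv_prod {α β : Type*} [MeasurableSpace α] [MeasurableSpace β] {μ μ₀ : Measure α}
    {ν ν₀ : Measure β} [SigmaFinite μ] [SigmaFinite μ₀] [SigmaFinite ν] [SigmaFinite ν₀]
    (hμ : μ ≪ μ₀) (hν : ν ≪ ν₀) :
    (μ.prod ν).rnDeriv (μ₀.prod ν₀) =ᵐ[μ₀.prod ν₀]
      fun p => μ.rnDeriv μ₀ p.1 * ν.rnDeriv ν₀ p.2 := by
  have h : μ.prod ν =
      (μ₀.prod ν₀).withDensity fun p => μ.rnDeriv μ₀ p.1 * ν.rnDeriv ν₀ p.2 := by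
    rw [← prod_withDensity (Measure.measurable_rnDeriv _ _) (Measure.measurable_rnDeriv _ _),
      Measure.withDensity_rnDeriv_eq _ _ hμ, Measure.withDensity_rnDeriv_eq _ _ hν]
  have hm : Measurable fun p : α × β => μ.rnDeriv μ₀ p.1 * ν.rnDeriv ν₀ p.2 :=
    ((Measure.measurable_rnDeriv _ _).comp measurable_fst).mul
      ((Measure.measurable_rnDeriv _ _).comp measurable_snd)
  conv_lhs => rw [h]
  exact Measure.rnDeriv_withDensity _ hm

theorem llr_prod {α β : Type*} [MeasurableSpace α] [MeasurableSpace β] {μ μ₀ : Measure α}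
    {ν ν₀ : Measure β} [SigmaFinite μ] [SigmaFinite μ₀] [SigmaFinite ν] [SigmaFinite ν₀]
    (hμ : μ ≪ μ₀) (hν : ν ≪ ν₀) :
    ∀ᵐ p ∂(μ.prod ν), llr (μ.prod ν) (μ₀.prod ν₀) p = llr μ μ₀ p.1 + llr ν ν₀ p.2 := by
  filter_upwards [(hμ.prod hν).ae_le (rnDeriv_prod hμ hν),
    Measure.quasiMeasurePreserving_fst.ae (rnDeriv_mem_Ioo hμ),
    Measure.quasiMeasurePreserving_snd.ae (rnDeriv_mem_Ioo hν)] with p h1 h2 h3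
  rw [llr, llr, llr, h1, ENNReal.toReal_mul, Real.log_mul]
  · exact (ENNReal.toReal_pos h2.1.ne' h2.2.ne).ne'
  · exact (ENNReal.toReal_pos h3.1.ne' h3.2.ne).ne'

theorem llr_map {α : Type*} [MeasureSpace α] [SigmaFinite (volume : Measure α)] {μ : Measure α}
    [SigmaFinite μ] {e : α → α} (he : MeasurePreserving e) (he' : MeasurableEmbedding e)
    (hμ : μ ≪ volume) : ∀ᵐ x ∂μ, llr (μ.map e) volume (e x) = llr μ volume x := by
  have h := he'.rnDeriv_map μ volume
  rw [he.map_eq] at h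
  filter_upwards [hμ.ae_le h] with x hx
  rw [llr, llr, hx]

/-- Both marginal densities are positive π-almost everywhere, hence so is the product density; this
gives absolute continuity and the subtraction of logarithms. -/
theorem llr_joint {α β : Type*} [MeasureSpace α] [MeasureSpace β]
    [SigmaFinite (volume : Measure α)] [SigmaFinite (volume : Measure β)]
    {π : Measure (α × β)} [IsProbabilityMeasure π] {μ : Measure α} {ν : Measure β}
    [IsProbabilityMeasure μ] [IsProbabilityMeasure ν] (h1 : MeasurePreserving Prod.fst π μ)
    (h2 : MeasurePreserving Prod.snd π ν) (hπ : π ≪ volume) (hμ : μ ≪ volume)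
    (hν : ν ≪ volume) : π ≪ μ.prod ν ∧ ∀ᵐ z ∂π, llr π (μ.prod ν) z =
      llr π volume z - (llr μ volume z.1 + llr ν volume z.2) := by
  have hac : μ.prod ν ≪ volume := hμ.prod hν
  have hpr : π ≪ μ.prod ν := by
    refine absolutelyContinuous_of_rnDeriv_ne_zero hπ hac ?_
    have := rnDeriv_prod hμ hν
    rw [← Measure.volume_eq_prod] at this
    filter_upwards [hπ.ae_le this, h1.quasiMeasurePreserving.ae (rnDeriv_mem_Ioo hμ),
      h2.quasiMeasurePreserving.ae (rnDeriv_mem_Ioo hν)] with z h3 h4 h5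
    rw [h3]
    exact mul_ne_zero h4.1.ne' h5.1.ne'
  refine ⟨hpr, ?_⟩
  have h3 := llr_prod hμ hν
  rw [← Measure.volume_eq_prod] at h3
  filter_upwards [llr_eq_sub hpr hac, hpr.ae_le h3] with z h4 h5
  rw [h4, h5]

theorem integral_llr_map {α : Type*} [MeasureSpace α] [SigmaFinite (volume : Measure α)]
    {μ : Measure α} [SigmaFinite μ] {e : α → α} (he : MeasurePreserving e)
    (he' : MeasurableEmbedding e) (hμ : μ ≪ volume) :
    (Integrable (llr (μ.map e) volume) (μ.map e) ↔ Integrable (llr μ volume) μ) ∧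
      ∫ x, llr (μ.map e) volume x ∂(μ.map e) = ∫ x, llr μ volume x ∂μ := by
  have h := llr_map he he' hμ
  constructor
  · rw [he'.integrable_map_iff]
    exact integrable_congr h
  · rw [he'.integral_map]
    exact integral_congr_ae h

/-- The determinant squares to 1, so its absolute value is 1. -/
theorem measurePreserving_of_involutive {E : Type*} [NormedAddCommGroup E] [NormedSpace ℝ E]
    [FiniteDimensional ℝ E] [MeasurableSpace E] [BorelSpace E] (μ : Measure E)
    [μ.IsAddHaarMeasure] {f : E →ₗ[ℝ] E} (hf : f ∘ₗ f = LinearMap.id) :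
    MeasurePreserving f μ μ := by
  have h1 : LinearMap.det f * LinearMap.det f = 1 := by
    rw [← LinearMap.det_comp, hf, LinearMap.det_id]
  have h2 : |LinearMap.det f| = 1 := by
    have : |LinearMap.det f| * |LinearMap.det f| = 1 := by rw [← abs_mul, h1, abs_one]
    nlinarith [abs_nonneg (LinearMap.det f)]
  refine ⟨f.continuous_of_finiteDimensional.measurable, ?_⟩
  rw [Measure.map_linearMap_addHaar_eq_smul_addHaar _ (left_ne_zero_of_mul_eq_one h1), abs_inv, h2]
  simp

/-! ### The rotation of the product space, with the signs arranged to make it an involution. -/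

section

variable {n : ℕ}

local notation "𝔼" => EuclideanSpace ℝ (Fin n)

/-- The involution `(x, y) ↦ (-b x + a y, a x + b y)`. -/
def rotationInvolution (n : ℕ) (a b : ℝ) :
    (EuclideanSpace ℝ (Fin n) × EuclideanSpace ℝ (Fin n)) →ₗ[ℝ]
      (EuclideanSpace ℝ (Fin n) × EuclideanSpace ℝ (Fin n)) :=
  LinearMap.prod (-b • LinearMap.fst ℝ _ _ + a • LinearMap.snd ℝ _ _)
    (a • LinearMap.fst ℝ _ _ + b • LinearMap.snd ℝ _ _)

theorem rotationInvolution_apply (a b : ℝ) (p : 𝔼 × 𝔼) :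
    rotationInvolution n a b p = (-b • p.1 + a • p.2, a • p.1 + b • p.2) := rfl

theorem rotationInvolution_comp_self {a b : ℝ} (hab : a ^ 2 + b ^ 2 = 1) :
    rotationInvolution n a b ∘ₗ rotationInvolution n a b = LinearMap.id := by
  refine LinearMap.ext fun p => ?_
  simp only [LinearMap.comp_apply, rotationInvolution_apply, LinearMap.id_apply]
  refine Prod.ext ?_ ?_
  · linear_combination (norm := module) hab • p.1
  · linear_combination (norm := module) hab • p.2

theorem measurePreserving_rotationInvolution {a b : ℝ} (hab : a ^ 2 + b ^ 2 = 1) :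
    MeasurePreserving (rotationInvolution n a b) :=
  measurePreserving_of_involutive ((volume : Measure 𝔼).prod volume)
    (rotationInvolution_comp_self hab)

theorem measurableEmbedding_rotationInvolution {a b : ℝ} (hab : a ^ 2 + b ^ 2 = 1) :
    MeasurableEmbedding (rotationInvolution n a b) := by
  have h := rotationInvolution_comp_self (n := n) hab
  exact (MeasurableEquiv.mk ⟨rotationInvolution n a b, rotationInvolution n a b,
    fun p => LinearMap.congr_fun h p, fun p => LinearMap.congr_fun h p⟩
    (measurePreserving_rotationInvolution hab).measurable
    (measurePreserving_rotationInvolution hab).measurable).measurableEmbedding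

end

section

variable {n : ℕ}

local notation "𝔼" => EuclideanSpace ℝ (Fin n)

theorem integrable_llr_prod {α β : Type*} [MeasureSpace α] [MeasureSpace β]
    [SigmaFinite (volume : Measure α)] [SigmaFinite (volume : Measure β)]
    {μ : Measure α} {ν : Measure β} [IsProbabilityMeasure μ] [IsProbabilityMeasure ν]
    (hμ : μ ≪ volume) (hν : ν ≪ volume) (hμi : Integrable (llr μ volume) μ)
    (hνi : Integrable (llr ν volume) ν) :
    Integrable (llr (μ.prod ν) volume) (μ.prod ν) ∧ ∫ p, llr (μ.prod ν) volume p ∂(μ.prod ν) =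
      ∫ x, llr μ volume x ∂μ + ∫ y, llr ν volume y ∂ν := by
  have h := llr_prod hμ hν
  rw [← Measure.volume_eq_prod] at h
  have h1 : Integrable (fun p : α × β => llr μ volume p.1) (μ.prod ν) := hμi.comp_fst ν
  have h2 : Integrable (fun p : α × β => llr ν volume p.2) (μ.prod ν) := hνi.comp_snd μ
  refine ⟨(integrable_congr h).2 (h1.add h2), ?_⟩
  rw [integral_congr_ae h, integral_add h1 h2, integral_fun_fst, integral_fun_snd]
  simp

theorem absolutelyContinuous_map_of_measurePreserving {α β : Type*} [MeasureSpace α]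
    [MeasureSpace β] {μ : Measure α} {e : α → β} (he : MeasurePreserving e) (hμ : μ ≪ volume) :
    μ.map e ≪ volume := by
  have := hμ.map he.measurable
  rwa [he.map_eq] at this

/-- The entropy power inequality for `-b X + a Y`. -/
theorem entropy_power_neg {a b : ℝ} (ha : 0 < a) (hb : 0 < b) (hab : a ^ 2 + b ^ 2 = 1)
    {μ ν τ : Measure 𝔼} [IsProbabilityMeasure μ] [IsProbabilityMeasure ν]
    [IsProbabilityMeasure τ] (hμ : μ ≪ volume) (hν : ν ≪ volume) (hτ : τ ≪ volume)
    (h : (μ.prod ν).map (fun p => -b • p.1 + a • p.2) = τ)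
    (hμi : Integrable (llr μ volume) μ) (hνi : Integrable (llr ν volume) ν)
    (hτi : ∫⁻ x, ENNReal.ofReal (-llr τ volume x) ∂τ ≠ ∞) :
    Integrable (llr τ volume) τ ∧
      ∫ x, llr τ volume x ∂τ ≤ b ^ 2 * ∫ x, llr μ volume x ∂μ + a ^ 2 * ∫ x, llr ν volume x ∂ν ∧
      (∫ x, llr τ volume x ∂τ = b ^ 2 * ∫ x, llr μ volume x ∂μ + a ^ 2 * ∫ x, llr ν volume x ∂ν →
        ∀ v, ∃ m₁ m₂ s, smoothedMarginal (μ.map Neg.neg) v = gaussianReal m₁ s ∧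
          smoothedMarginal ν v = gaussianReal m₂ s) := by
  have hneg : MeasurePreserving (Neg.neg : 𝔼 → 𝔼) := Measure.measurePreserving_neg _
  have hemb : MeasurableEmbedding (Neg.neg : 𝔼 → 𝔼) := (MeasurableEquiv.neg 𝔼).measurableEmbedding
  have hP : IsProbabilityMeasure (μ.map Neg.neg) :=
    Measure.isProbabilityMeasure_map hneg.measurable.aemeasurable
  obtain ⟨h1, h2⟩ := integral_llr_map hneg hemb hμ
  have h3 : ((μ.map Neg.neg).prod ν).map (fun p => b • p.1 + a • p.2) = τ := by
    have h4 : MeasurePreserving (Prod.map Neg.neg id) (μ.prod ν) ((μ.map Neg.neg).prod ν) :=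
      (hneg.measurable.measurePreserving μ).prod (MeasurePreserving.id ν)
    rw [← h4.map_eq, Measure.map_map (by fun_prop) h4.measurable, ← h]
    congr 1
    ext1 p
    simp
  -- The entropy-power inequality for -X and Y with a and b exchanged; reflection preserves volume
  -- and hence entropy.
  have := entropy_power hb ha (by linarith) (absolutelyContinuous_map_of_measurePreserving hneg hμ)
    hν hτ h3 (h1.2 hμi) hνi hτi
  rwa [h2] at this

/-- The log-likelihood ratio of the law of `(-b X + a Y, a X + b Y)`. -/
theorem llr_rotation {a b : ℝ} (hab : a ^ 2 + b ^ 2 = 1) {μ ν : Measure 𝔼}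
    [IsProbabilityMeasure μ] [IsProbabilityMeasure ν] (hμ : μ ≪ volume) (hν : ν ≪ volume) :
    ∀ᵐ p ∂(μ.prod ν), llr ((μ.prod ν).map (rotationInvolution n a b)) volume
      (rotationInvolution n a b p) = llr μ volume p.1 + llr ν volume p.2 := by
  have h := llr_prod hμ hν
  rw [← Measure.volume_eq_prod] at h
  filter_upwards [h, llr_map (measurePreserving_rotationInvolution hab)
    (measurableEmbedding_rotationInvolution hab) (hμ.prod hν)] with p h1 h2
  rw [h2, h1]

/-- Transfers `integrable_llr_of_lintegral_cond` to V = -bX + aY by reflecting X; at a rotated point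
the joint log-density is the sum of those of X and Y. -/
theorem integrable_llr_of_lintegral_rotation {a b : ℝ} (ha : 0 < a) (hb : 0 < b)
    (hab : a ^ 2 + b ^ 2 = 1)
    {μ ν τ : Measure 𝔼} [IsProbabilityMeasure μ] [IsProbabilityMeasure ν]
    [IsProbabilityMeasure τ] (hμ : μ ≪ volume) (hν : ν ≪ volume) (hτ : τ ≪ volume)
    (h : (μ.prod ν).map (fun p => -b • p.1 + a • p.2) = τ)
    (hμi : ∫⁻ x, ENNReal.ofReal (-llr μ volume x) ∂μ ≠ ∞)
    (hνi : ∫⁻ x, ENNReal.ofReal (-llr ν volume x) ∂ν ≠ ∞)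
    (hc : ∫⁻ z, ENNReal.ofReal (llr ((μ.prod ν).map (rotationInvolution n a b)) volume z -
      llr τ volume z.1) ∂((μ.prod ν).map (rotationInvolution n a b)) ≠ ∞) :
    Integrable (llr μ volume) μ ∧ Integrable (llr ν volume) ν := by
  have hneg : MeasurePreserving (Neg.neg : 𝔼 → 𝔼) := Measure.measurePreserving_neg _
  have hemb : MeasurableEmbedding (Neg.neg : 𝔼 → 𝔼) := (MeasurableEquiv.neg 𝔼).measurableEmbedding
  have hP : IsProbabilityMeasure (μ.map Neg.neg) :=
    Measure.isProbabilityMeasure_map hneg.measurable.aemeasurable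
  have h4 : MeasurePreserving (Prod.map Neg.neg id) (μ.prod ν) ((μ.map Neg.neg).prod ν) :=
    (hneg.measurable.measurePreserving μ).prod (MeasurePreserving.id ν)
  have h3 : ((μ.map Neg.neg).prod ν).map (fun p => b • p.1 + a • p.2) = τ := by
    rw [← h4.map_eq, Measure.map_map (by fun_prop) h4.measurable, ← h]
    congr 1
    ext1 p
    simp
  have hm := llr_map hneg hemb hμ
  have hμm := measurable_llr (μ.map Neg.neg) (volume : Measure 𝔼)
  have hνm := measurable_llr ν (volume : Measure 𝔼)
  have hτm := measurable_llr τ (volume : Measure 𝔼)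
  have hR := measurePreserving_rotationInvolution (n := n) hab
  have := integrable_llr_of_lintegral_cond hb ha (by linarith)
    (absolutelyContinuous_map_of_measurePreserving hneg hμ) hν hτ h3 ?_ hνi ?_
  · exact ⟨(integral_llr_map hneg hemb hμ).1.1 this.1, this.2⟩
  · rw [lintegral_map (f := fun x => ENNReal.ofReal (-llr (μ.map Neg.neg) volume x))
      hμm.neg.ennreal_ofReal hneg.measurable]
    rwa [lintegral_congr_ae (g := fun x => ENNReal.ofReal (-llr μ volume x))
      (hm.mono fun x hx => by simp only [hx])]
  · rw [← h4.lintegral_comp (f := fun p : 𝔼 × 𝔼 => ENNReal.ofReal (llr (μ.map Neg.neg) volume p.1 +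
      llr ν volume p.2 - llr τ volume (b • p.1 + a • p.2))) (by fun_prop)]
    rw [lintegral_map measurable_llr_sub.ennreal_ofReal hR.measurable] at hc
    convert hc using 1
    refine lintegral_congr_ae ?_
    filter_upwards [llr_rotation hab hμ hν, Measure.quasiMeasurePreserving_fst.ae hm] with p h1 h2
    rw [h1]
    simp only [Prod.map_fst, Prod.map_snd, id, h2, rotationInvolution_apply]
    simp

/-- The entropy of a vector with finite first moment is not `+∞`. -/
theorem lintegral_neg_llr_map_ne_top {Ω : Type*} [MeasurableSpace Ω] {P : Measure Ω}
    [IsProbabilityMeasure P] {X : Ω → 𝔼} (hX : Integrable X P) (h : P.map X ≪ volume) :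
    ∫⁻ x, ENNReal.ofReal (-llr (P.map X) volume x) ∂(P.map X) ≠ ∞ := by
  obtain ⟨r, C, hr, hC, hrC⟩ := lintegral_neg_llr_le 𝔼
  refine ((hrC (P.map X) (Measure.isProbabilityMeasure_map hX.aemeasurable) h).trans_lt ?_).ne
  rw [lintegral_map' measurable_enorm.aemeasurable hX.aemeasurable]
  exact ENNReal.add_lt_top.2 ⟨ENNReal.mul_lt_top hr.lt_top hX.2, hC.lt_top⟩

/-- The mutual information of two vectors with finite entropies. -/
theorem klDiv_joint {α β : Type*} [MeasureSpace α] [MeasureSpace β]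
    [SigmaFinite (volume : Measure α)] [SigmaFinite (volume : Measure β)]
    {π : Measure (α × β)} [IsProbabilityMeasure π] {μ : Measure α} {ν : Measure β}
    [IsProbabilityMeasure μ] [IsProbabilityMeasure ν] (h1 : MeasurePreserving Prod.fst π μ)
    (h2 : MeasurePreserving Prod.snd π ν) (hπ : π ≪ volume) (hμ : μ ≪ volume)
    (hν : ν ≪ volume) (hπi : Integrable (llr π volume) π) (hμi : Integrable (llr μ volume) μ)
    (hνi : Integrable (llr ν volume) ν) :
    InformationTheory.klDiv π (μ.prod ν) = ENNReal.ofReal (∫ z, llr π volume z ∂π -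
      (∫ x, llr μ volume x ∂μ + ∫ y, llr ν volume y ∂ν)) ∧
    0 ≤ ∫ z, llr π volume z ∂π - (∫ x, llr μ volume x ∂μ + ∫ y, llr ν volume y ∂ν) := by
  obtain ⟨hac, hl⟩ := llr_joint h1 h2 hπ hμ hν
  have i1 : Integrable (fun z : α × β => llr μ volume z.1) π := h1.integrable_comp_of_integrable hμi
  have i2 : Integrable (fun z : α × β => llr ν volume z.2) π := h2.integrable_comp_of_integrable hνi
  have e1 : ∫ z, llr μ volume z.1 ∂π = ∫ x, llr μ volume x ∂μ := by
    rw [← h1.map_eq, integral_map h1.measurable.aemeasurable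
      (measurable_llr _ _).aestronglyMeasurable]
  have e2 : ∫ z, llr ν volume z.2 ∂π = ∫ x, llr ν volume x ∂ν := by
    rw [← h2.map_eq, integral_map h2.measurable.aemeasurable
      (measurable_llr _ _).aestronglyMeasurable]
  have i12 : Integrable (fun z : α × β => llr μ volume z.1 + llr ν volume z.2) π := i1.add i2
  have i3 : Integrable (llr π (μ.prod ν)) π := (integrable_congr hl).2 (hπi.sub i12)
  have e3 : ∫ z, llr π (μ.prod ν) z ∂π = ∫ z, llr π volume z ∂π -
      (∫ x, llr μ volume x ∂μ + ∫ y, llr ν volume y ∂ν) := by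
    rw [integral_congr_ae hl, integral_sub hπi i12, integral_add i1 i2, e1, e2]
  have h3 := InformationTheory.toReal_klDiv_of_measure_eq hac (by simp)
  rw [e3] at h3
  rw [← h3, ENNReal.ofReal_toReal (InformationTheory.klDiv_ne_top hac i3)]
  exact ⟨rfl, ENNReal.toReal_nonneg⟩

end

/-! ### Centred Gaussian laws -/

section

variable {n : ℕ}

local notation "𝔼" => EuclideanSpace ℝ (Fin n)

/-- Divide the characteristic function of N + ⟨v,X⟩ by that of N, which never vanishes; no
decomposition theorem for Gaussian laws is needed. -/
theorem map_inner_eq_gaussianReal_of_smoothedMarginal {μ : Measure 𝔼} [IsProbabilityMeasure μ]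
    {v : 𝔼} {m : ℝ} {s : NNReal} (h : smoothedMarginal μ v = gaussianReal m s) :
    μ.map (fun x => inner ℝ v x) = gaussianReal m (s - 1) := by
  have hP : IsProbabilityMeasure (μ.map fun x => inner ℝ v x) :=
    Measure.isProbabilityMeasure_map (by fun_prop)
  have h1 : smoothedMarginal μ v = stdGauss ∗ μ.map (fun x => inner ℝ v x) := by
    have h4 : MeasurePreserving (Prod.map id fun x : 𝔼 => inner ℝ v x) (stdGauss.prod μ)
        (stdGauss.prod (μ.map fun x => inner ℝ v x)) :=
      (MeasurePreserving.id _).prod (Measurable.measurePreserving (by fun_prop) μ)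
    rw [Measure.conv, ← h4.map_eq, Measure.map_map (by fun_prop) h4.measurable]
    rfl
  have h2 : ∀ t : ℝ, charFun (μ.map fun x => inner ℝ v x) t =
      Complex.exp (t * m * Complex.I - ((s : ℝ) - 1 : ℝ) * t ^ 2 / 2) := by
    intro t
    have h3 : charFun (smoothedMarginal μ v) t = charFun stdGauss t *
        charFun (μ.map fun x => inner ℝ v x) t := by rw [h1, charFun_conv]
    rw [h, charFun_gaussianReal, charFun_gaussianReal] at h3
    rw [← mul_right_inj' (Complex.exp_ne_zero (t * (0 : ℝ) * Complex.I - (1 : NNReal) * t ^ 2 / 2)),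
      ← h3, ← Complex.exp_add]
    congr 1
    push_cast
    ring
  -- A characteristic function is bounded by 1 in modulus; at t = 1 this makes the truncated
  -- difference `s - 1` a true difference.
  have hs : 1 ≤ s := by
    have h3 := norm_charFun_le_one (μ := μ.map fun x => inner ℝ v x) (1 : ℝ)
    rw [h2, Complex.norm_exp, Real.exp_le_one_iff] at h3
    have h4 : (((1 : ℝ) : ℂ) * m * Complex.I - ((s : ℝ) - 1 : ℝ) * ((1 : ℝ) : ℂ) ^ 2 / 2).re =
        -((s : ℝ) - 1) / 2 := by
      simp
      ring
    rw [h4] at h3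
    have : (1 : ℝ) ≤ s := by linarith
    exact_mod_cast this
  refine Measure.ext_of_charFun ?_
  ext1 t
  rw [h2, charFun_gaussianReal, NNReal.coe_sub hs]
  simp

/-- Two laws all of whose marginals are centred Gaussian with the same variances. -/
def CenteredGaussianPair (μ ν : Measure 𝔼) : Prop :=
  ∀ L : StrongDual ℝ 𝔼, ∃ s, μ.map L = gaussianReal 0 s ∧ ν.map L = gaussianReal 0 s

theorem eq_zero_of_map_eq_gaussianReal {μ : Measure 𝔼} [IsProbabilityMeasure μ]
    (hi : Integrable id μ) (h0 : ∫ x, x ∂μ = 0) {L : StrongDual ℝ 𝔼} {m : ℝ} {s : NNReal}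
    (h : μ.map L = gaussianReal m s) : m = 0 := by
  have h1 := integral_id_gaussianReal (μ := m) (v := s)
  rw [← h, integral_map (by fun_prop) (by fun_prop)] at h1
  have h2 : ∫ x, L x ∂μ = L (∫ x, x ∂μ) := L.integral_comp_comm hi
  rw [← h1, h2, h0, map_zero]

theorem centeredGaussianPair_of_smoothedMarginal {μ ν : Measure 𝔼} [IsProbabilityMeasure μ]
    [IsProbabilityMeasure ν] (hμ : Integrable id μ) (hμ0 : ∫ x, x ∂μ = 0)
    (hν : Integrable id ν) (hν0 : ∫ x, x ∂ν = 0)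
    (h : ∀ v, ∃ m₁ m₂ s, smoothedMarginal μ v = gaussianReal m₁ s ∧
      smoothedMarginal ν v = gaussianReal m₂ s) : CenteredGaussianPair μ ν := by
  intro L
  obtain ⟨m₁, m₂, s, h1, h2⟩ := h ((InnerProductSpace.toDual ℝ 𝔼).symm L)
  have h3 := map_inner_eq_gaussianReal_of_smoothedMarginal h1
  have h4 := map_inner_eq_gaussianReal_of_smoothedMarginal h2
  simp only [InnerProductSpace.toDual_symm_apply] at h3 h4
  refine ⟨s - 1, ?_, ?_⟩
  · rwa [eq_zero_of_map_eq_gaussianReal hμ hμ0 h3] at h3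
  · rwa [eq_zero_of_map_eq_gaussianReal hν hν0 h4] at h4

theorem CenteredGaussianPair.of_map_neg {μ ν : Measure 𝔼}
    (h : CenteredGaussianPair (μ.map Neg.neg) ν) : CenteredGaussianPair μ ν := by
  intro L
  obtain ⟨s, h1, h2⟩ := h L
  refine ⟨s, ?_, h2⟩
  have h3 : μ.map L = ((μ.map Neg.neg).map L).map Neg.neg := by
    rw [Measure.map_map (by fun_prop) (by fun_prop), Measure.map_map (by fun_prop) (by fun_prop)]
    congr 1
    ext1 x
    simp
  rw [h3, h1]
  simpa using gaussianReal_map_neg (μ := 0) (v := s)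

theorem CenteredGaussianPair.isGaussian {μ ν : Measure 𝔼} (h : CenteredGaussianPair μ ν) :
    IsGaussian μ ∧ IsGaussian ν :=
  ⟨isGaussian_of_map_eq_gaussianReal fun L => ⟨0, (h L).imp fun _ hs => hs.1⟩,
    isGaussian_of_map_eq_gaussianReal fun L => ⟨0, (h L).imp fun _ hs => hs.2⟩⟩

theorem CenteredGaussianPair.eq {μ ν : Measure 𝔼} [IsFiniteMeasure μ] [IsFiniteMeasure ν]
    (h : CenteredGaussianPair μ ν) : μ = ν := by
  refine Measure.ext_of_charFunDual ?_
  ext1 L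
  obtain ⟨s, h1, h2⟩ := h L
  rw [charFunDual_eq_charFun_map_one, charFunDual_eq_charFun_map_one, h1, h2]

theorem centeredGaussianPair_self {μ : Measure 𝔼} [IsGaussian μ] (h0 : ∫ x, x ∂μ = 0) :
    CenteredGaussianPair μ μ := by
  intro L
  have h := IsGaussian.map_eq_gaussianReal (μ := μ) L
  have := eq_zero_of_map_eq_gaussianReal IsGaussian.integrable_id h0 h
  rw [this] at h
  exact ⟨_, h, h⟩

/-- Checked on one-dimensional images: independent centred Gaussian variables of variance s combine
to variance (c²+d²)s = s. -/
theorem CenteredGaussianPair.map_prod {μ : Measure 𝔼} [IsProbabilityMeasure μ]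
    (h : CenteredGaussianPair μ μ) {c d : ℝ} (hcd : c ^ 2 + d ^ 2 = 1) :
    (μ.prod μ).map (fun p => c • p.1 + d • p.2) = μ := by
  refine CenteredGaussianPair.eq fun L => ?_
  obtain ⟨s, hs, -⟩ := h L
  refine ⟨s, ?_, hs⟩
  have hL : MeasurePreserving L μ (gaussianReal 0 s) := ⟨by fun_prop, hs⟩
  have hc : MeasurePreserving (fun x : ℝ => c * x) (gaussianReal 0 s)
    (gaussianReal (c * 0) (.mk (c ^ 2) (sq_nonneg _) * s)) :=
    ⟨by fun_prop, gaussianReal_map_const_mul c⟩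
  have hd : MeasurePreserving (fun x : ℝ => d * x) (gaussianReal 0 s)
    (gaussianReal (d * 0) (.mk (d ^ 2) (sq_nonneg _) * s)) :=
    ⟨by fun_prop, gaussianReal_map_const_mul d⟩
  have hp := (hc.comp hL).prod (hd.comp hL)
  have h1 : ((μ.prod μ).map (fun p => c • p.1 + d • p.2)).map L =
      ((μ.prod μ).map (Prod.map ((fun x : ℝ => c * x) ∘ L) ((fun x : ℝ => d * x) ∘ L))).map
        fun p => p.1 + p.2 := by
    rw [Measure.map_map (by fun_prop) (by fun_prop), Measure.map_map (by fun_prop) hp.measurable]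
    congr 1
    ext1 p
    simp
  rw [h1, hp.map_eq, ← Measure.conv, gaussianReal_conv_gaussianReal]
  congr 1
  · simp
  · rw [← add_mul]
    convert one_mul s
    ext
    simpa using hcd

end

/-! ### Entropies and mutual information of the rotated pair. -/

section

variable {n : ℕ}

local notation "𝔼" => EuclideanSpace ℝ (Fin n)

/-- The entropy balance of the rotation `(U, V) = (a X + b Y, -b X + a Y)`: when `X` and `Y` have
integrable log-densities, the entropies of `U` and `V`, the mutual information and the equality
cases in terms of integrals of log-densities. -/
theorem entropy_balance {Ω : Type*} [MeasurableSpace Ω] {P : Measure Ω} [IsProbabilityMeasure P]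
    {X Y : Ω → 𝔼} (hX : P.map X ≪ volume) (hY : P.map Y ≪ volume)
    (hXint : Integrable X P) (hYint : Integrable Y P)
    (hXmean : ∫ ω, X ω ∂P = 0) (hYmean : ∫ ω, Y ω ∂P = 0) (hXY : IndepFun X Y P)
    {a b : ℝ} (ha : 0 < a) (hb : 0 < b) (hab : a ^ 2 + b ^ 2 = 1) {U V : Ω → 𝔼}
    (hU : U = fun ω => a • X ω + b • Y ω) (hV : V = fun ω => -b • X ω + a • Y ω) :
    (condDiffEntropy U V P ≠ ⊥ → Integrable (llr (P.map X) volume) (P.map X) ∧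
      Integrable (llr (P.map Y) volume) (P.map Y)) ∧
    (Integrable (llr (P.map X) volume) (P.map X) → Integrable (llr (P.map Y) volume) (P.map Y) →
      -- `A`, `B`, `C`, `D` are the entropies of X, Y, U, V.
      ∃ A B C D : ℝ, diffEntropy X P = (A : EReal) ∧ diffEntropy Y P = (B : EReal) ∧
        diffEntropy U P = (C : EReal) ∧ condDiffEntropy U V P = ((A + B - D : ℝ) : EReal) ∧
        mutualInfo U V P = ENNReal.ofReal (C + D - (A + B)) ∧ 0 ≤ C + D - (A + B) ∧
        a ^ 2 * A + b ^ 2 * B ≤ C ∧ b ^ 2 * A + a ^ 2 * B ≤ D ∧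
        (C = a ^ 2 * A + b ^ 2 * B ↔ IdentGaussian X Y P) ∧
        (D = b ^ 2 * A + a ^ 2 * B ↔ IdentGaussian X Y P)) := by
  have hXm := hXint.aemeasurable
  have hYm := hYint.aemeasurable
  have hUint : Integrable U P := by
    rw [hU]; exact (hXint.smul a).add (hYint.smul b)
  have hVint : Integrable V P := by
    rw [hV]; exact (hXint.smul (-b)).add (hYint.smul a)
  have hUm := hUint.aemeasurable
  have hVm := hVint.aemeasurable
  have pX : IsProbabilityMeasure (P.map X) := Measure.isProbabilityMeasure_map hXm
  have pY : IsProbabilityMeasure (P.map Y) := Measure.isProbabilityMeasure_map hYm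
  have pU : IsProbabilityMeasure (P.map U) := Measure.isProbabilityMeasure_map hUm
  have pV : IsProbabilityMeasure (P.map V) := Measure.isProbabilityMeasure_map hVm
  have hprod : P.map (fun ω => (X ω, Y ω)) = (P.map X).prod (P.map Y) :=
    (indepFun_iff_map_prod_eq_prod_map_map hXm hYm).1 hXY
  have hR := measurePreserving_rotationInvolution (n := n) hab
  have hRe := measurableEmbedding_rotationInvolution (n := n) hab
  have hπ : P.map (fun ω => (V ω, U ω)) =
      ((P.map X).prod (P.map Y)).map (rotationInvolution n a b) := by
    rw [← hprod, AEMeasurable.map_map_of_aemeasurable hR.measurable.aemeasurable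
      (hXm.prodMk hYm), hU, hV]
    rfl
  have hUlaw : ((P.map X).prod (P.map Y)).map (fun p => a • p.1 + b • p.2) = P.map U := by
    rw [← hprod, AEMeasurable.map_map_of_aemeasurable (by fun_prop) (hXm.prodMk hYm), hU]
    rfl
  have hVlaw : ((P.map X).prod (P.map Y)).map (fun p => -b • p.1 + a • p.2) = P.map V := by
    rw [← hprod, AEMeasurable.map_map_of_aemeasurable (by fun_prop) (hXm.prodMk hYm), hV]
    rfl
  -- V comes first because disintegration conditions on the first coordinate.
  set π := P.map (fun ω => (V ω, U ω)) with hπdef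
  have pπ : IsProbabilityMeasure π := Measure.isProbabilityMeasure_map (hVm.prodMk hUm)
  have hπac : π ≪ volume := by
    rw [hπ]; exact absolutelyContinuous_map_of_measurePreserving hR (hX.prod hY)
  have hfst : MeasurePreserving Prod.fst π (P.map V) := by
    refine ⟨measurable_fst, ?_⟩
    rw [hπdef, AEMeasurable.map_map_of_aemeasurable (by fun_prop) (hVm.prodMk hUm)]
    rfl
  have hsnd : MeasurePreserving Prod.snd π (P.map U) := by
    refine ⟨measurable_snd, ?_⟩
    rw [hπdef, AEMeasurable.map_map_of_aemeasurable (by fun_prop) (hVm.prodMk hUm)]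
    rfl
  have hVac : P.map V ≪ volume := by
    rw [← hfst.map_eq]
    exact (hπac.map measurable_fst).trans Measure.quasiMeasurePreserving_fst.absolutelyContinuous
  have hUac : P.map U ≪ volume := by
    rw [← hsnd.map_eq]
    exact (hπac.map measurable_snd).trans Measure.quasiMeasurePreserving_snd.absolutelyContinuous
  have hκ : π = (P.map V) ⊗ₘ condDistrib U V P := (compProd_map_condDistrib hUm).symm
  refine ⟨fun h => ?_, fun hXi hYi => ?_⟩
  · have hmom : ∫⁻ z, ‖z.2‖ₑ ∂π ≠ ∞ := by
      rw [hsnd.lintegral_comp (f := fun u : 𝔼 => ‖u‖ₑ) measurable_enorm,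
        lintegral_map' measurable_enorm.aemeasurable hUm]
      exact hUint.2.ne
    have h1 := lintegral_llr_kernel_ne_top hπac hκ hmom h
    rw [hπ] at h1
    exact integrable_llr_of_lintegral_rotation ha hb hab hX hY hVac hVlaw
      (lintegral_neg_llr_map_ne_top hXint hX) (lintegral_neg_llr_map_ne_top hYint hY) h1
  obtain ⟨hUi, hUle, hUeq⟩ := entropy_power ha hb hab hX hY hUac hUlaw hXi hYi
    (lintegral_neg_llr_map_ne_top hUint hUac)
  obtain ⟨hVi, hVle, hVeq⟩ := entropy_power_neg ha hb hab hX hY hVac hVlaw hXi hYi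
    (lintegral_neg_llr_map_ne_top hVint hVac)
  obtain ⟨hpi, hpe⟩ := integrable_llr_prod hX hY hXi hYi
  obtain ⟨hπi, hπe⟩ := integral_llr_map hR hRe (hX.prod hY)
  rw [← hπ] at hπi hπe
  have hπi' := hπi.2 hpi
  rw [hpe] at hπe
  -- h(U|V) = h(V,U) - h(V), and the volume-preserving rotation gives h(V,U) = h(X) + h(Y).
  have hcond : condDiffEntropy U V P = ((-∫ x, llr (P.map X) volume x ∂(P.map X) +
      -∫ x, llr (P.map Y) volume x ∂(P.map Y) -
        -∫ x, llr (P.map V) volume x ∂(P.map V) : ℝ) : EReal) := by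
    have i1 : Integrable (fun z : 𝔼 × 𝔼 => llr (P.map V) volume z.1) π :=
      hfst.integrable_comp_of_integrable hVi
    have e1 : ∫ z, llr (P.map V) volume z.1 ∂π = ∫ x, llr (P.map V) volume x ∂(P.map V) := by
      rw [← integral_map (φ := Prod.fst) (f := llr (P.map V) volume) hfst.measurable.aemeasurable
        (measurable_llr _ _).aestronglyMeasurable, hfst.map_eq]
    rw [condDiffEntropy, eintegral_lawEntropy_eq hπac hκ (hπi'.sub i1), integral_sub hπi' i1, e1,
      hπe]
    congr 1
    ring
  have hswap : MeasurePreserving (Prod.swap : 𝔼 × 𝔼 → 𝔼 × 𝔼) := Measure.measurePreserving_swap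
  have hswape : MeasurableEmbedding (Prod.swap : 𝔼 × 𝔼 → 𝔼 × 𝔼) :=
    MeasurableEquiv.prodComm.measurableEmbedding
  have hJ : P.map (fun ω => (U ω, V ω)) = π.map Prod.swap := by
    rw [hπdef, AEMeasurable.map_map_of_aemeasurable (by fun_prop) (hVm.prodMk hUm)]
    rfl
  obtain ⟨hJi, hJe⟩ := integral_llr_map hswap hswape hπac
  rw [← hJ] at hJi hJe
  have pJ : IsProbabilityMeasure (P.map fun ω => (U ω, V ω)) :=
    Measure.isProbabilityMeasure_map (hUm.prodMk hVm)
  obtain ⟨hI, hI0⟩ := klDiv_joint (π := P.map fun ω => (U ω, V ω)) (μ := P.map U) (ν := P.map V)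
    ⟨measurable_fst, by
      rw [AEMeasurable.map_map_of_aemeasurable (by fun_prop) (hUm.prodMk hVm)]; rfl⟩
    ⟨measurable_snd, by
      rw [AEMeasurable.map_map_of_aemeasurable (by fun_prop) (hUm.prodMk hVm)]; rfl⟩
    (by rw [hJ]; exact absolutelyContinuous_map_of_measurePreserving hswap hπac) hUac hVac
    (hJi.2 hπi') hUi hVi
  rw [hJe, hπe] at hI hI0
  have mX : Integrable id (P.map X) ∧ ∫ x, x ∂(P.map X) = 0 :=
    ⟨(integrable_map_measure aestronglyMeasurable_id hXm).2 hXint, by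
      rw [integral_map hXm (by fun_prop)]; exact hXmean⟩
  have mY : Integrable id (P.map Y) ∧ ∫ x, x ∂(P.map Y) = 0 :=
    ⟨(integrable_map_measure aestronglyMeasurable_id hYm).2 hYint, by
      rw [integral_map hYm (by fun_prop)]; exact hYmean⟩
  have hG : CenteredGaussianPair (P.map X) (P.map Y) → IdentGaussian X Y P := fun h =>
    ⟨⟨h.isGaussian.1⟩, ⟨h.isGaussian.2⟩, ⟨hXm, hYm, h.eq⟩⟩
  -- Rotation invariance of i.i.d. centred Gaussian vectors: U and V have the law of X, so equality
  -- holds in both entropy-power inequalities.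
  have hG' : IdentGaussian X Y P →
      P.map Y = P.map X ∧ P.map U = P.map X ∧ P.map V = P.map X := by
    rintro ⟨h1, -, h2⟩
    have h3 := h2.map_eq.symm
    have := h1.isGaussian_map
    have h4 := centeredGaussianPair_self mX.2
    rw [h3] at hUlaw hVlaw
    exact ⟨h3, hUlaw ▸ h4.map_prod hab, hVlaw ▸ h4.map_prod (by linarith [neg_sq b])⟩
  have pN : IsProbabilityMeasure ((P.map X).map Neg.neg) :=
    Measure.isProbabilityMeasure_map (by fun_prop)
  refine ⟨_, _, _, _, lawEntropy_eq_integral hX hXi, lawEntropy_eq_integral hY hYi,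
    lawEntropy_eq_integral hUac hUi, hcond, ?_, ?_, ?_, ?_, ⟨fun h => ?_, fun h => ?_⟩,
    ⟨fun h => ?_, fun h => ?_⟩⟩
  · rw [mutualInfo, hI]
    congr 1
    ring
  · linarith
  · linarith
  · linarith
  · exact hG (centeredGaussianPair_of_smoothedMarginal mX.1 mX.2 mY.1 mY.2 (hUeq (by linarith)))
  · obtain ⟨h1, h2, -⟩ := hG' h
    rw [h1, h2, ← add_mul, hab, one_mul]
  · refine hG (CenteredGaussianPair.of_map_neg (centeredGaussianPair_of_smoothedMarginal ?_ ?_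
      mY.1 mY.2 (hVeq (by linarith))))
    · exact (integrable_map_measure aestronglyMeasurable_id (by fun_prop)).2 mX.1.neg
    · rw [integral_map (by fun_prop) (by fun_prop), integral_neg, mX.2, neg_zero]
  · obtain ⟨h1, -, h2⟩ := hG' h
    rw [h1, h2, ← add_mul, add_comm, hab, one_mul]

end

end EntropyPower

/-! ### The reverse inequality and the deficit bounds. -/

theorem mainTheorem3 {Ω : Type*} [MeasurableSpace Ω] (P : Measure Ω) [IsProbabilityMeasure P]
    (n : ℕ) (X Y : Ω → EuclideanSpace ℝ (Fin n))
    (hXpdf : HasPDF X P volume) (hYpdf : HasPDF Y P volume)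
    (hXint : Integrable X P) (hYint : Integrable Y P)
    (hXmean : ∫ ω, X ω ∂P = 0) (hYmean : ∫ ω, Y ω ∂P = 0)
    (hXY : IndepFun X Y P)
    (t : ℝ) (ht0 : 0 < t) (ht1 : t < 1)
    (U V : Ω → EuclideanSpace ℝ (Fin n))
    (hU : U = fun ω => √t • X ω + √(1 - t) • Y ω)
    (hV : V = fun ω => -√(1 - t) • X ω + √t • Y ω) :
    -- the reverse entropy-power inequality (both sides may be `-∞`)
    condDiffEntropy U V P ≤
        (t : EReal) * diffEntropy X P + ((1 - t : ℝ) : EReal) * diffEntropy Y P ∧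
    -- when `h(X)` and `h(Y)` are finite: deficit bounds and equality cases
    (diffEntropy X P ≠ ⊥ → diffEntropy Y P ≠ ⊥ →
      mutualInfo U V P ≠ ∞ ∧
      diffEntropy U P = condDiffEntropy U V P + (mutualInfo U V P : EReal) ∧
      0 ≤ diffEntropy U P -
        ((t : EReal) * diffEntropy X P + ((1 - t : ℝ) : EReal) * diffEntropy Y P) ∧
      diffEntropy U P -
        ((t : EReal) * diffEntropy X P + ((1 - t : ℝ) : EReal) * diffEntropy Y P) ≤
          (mutualInfo U V P : EReal) ∧
      (condDiffEntropy U V P =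
        (t : EReal) * diffEntropy X P + ((1 - t : ℝ) : EReal) * diffEntropy Y P ↔
          IdentGaussian X Y P) ∧
      (diffEntropy U P -
        ((t : EReal) * diffEntropy X P + ((1 - t : ℝ) : EReal) * diffEntropy Y P) = 0 ↔
          IdentGaussian X Y P) ∧
      (diffEntropy U P -
        ((t : EReal) * diffEntropy X P + ((1 - t : ℝ) : EReal) * diffEntropy Y P) =
          (mutualInfo U V P : EReal) ↔ IdentGaussian X Y P) ∧
      (mutualInfo U V P = 0 ↔ IdentGaussian X Y P)) := by
  have hXac : P.map X ≪ volume := hXpdf.absolutelyContinuous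
  have hYac : P.map Y ≪ volume := hYpdf.absolutelyContinuous
  have pX := Measure.isProbabilityMeasure_map hXint.aemeasurable
  have pY := Measure.isProbabilityMeasure_map hYint.aemeasurable
  have ha2 : √t ^ 2 = t := Real.sq_sqrt ht0.le
  have hb2 : √(1 - t) ^ 2 = 1 - t := Real.sq_sqrt (by linarith)
  obtain ⟨h1, h2⟩ := EntropyPower.entropy_balance hXac hYac hXint hYint hXmean hYmean hXY
    (Real.sqrt_pos.2 ht0) (Real.sqrt_pos.2 (by linarith : 0 < 1 - t))
    (by rw [ha2, hb2]; ring) hU hV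
  rw [ha2, hb2] at h2
  refine ⟨?_, fun hX hY => ?_⟩
  -- If h(U|V) is not -∞, then h(X) and h(Y) are finite and the inequality is one between real
  -- numbers.
  · by_cases h : condDiffEntropy U V P = ⊥
    · rw [h]
      exact bot_le
    obtain ⟨A, B, C, D, hA, hB, -, hD, -, -, -, hle, -⟩ := h2 (h1 h).1 (h1 h).2
    rw [hA, hB, hD, ← EReal.coe_mul, ← EReal.coe_mul, ← EReal.coe_add, EReal.coe_le_coe_iff]
    linarith
  obtain ⟨A, B, C, D, hA, hB, hC, hD, hI, hI0, hUle, hVle, hUeq, hVeq⟩ := h2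
    (EntropyPower.integrable_llr_of_lawEntropy_ne_bot hXac
      (EntropyPower.lintegral_neg_llr_map_ne_top hXint hXac) hX)
    (EntropyPower.integrable_llr_of_lawEntropy_ne_bot hYac
      (EntropyPower.lintegral_neg_llr_map_ne_top hYint hYac) hY)
  have hI' : (mutualInfo U V P : EReal) = ((C + D - (A + B) : ℝ) : EReal) := by
    rw [hI, EReal.coe_ennreal_ofReal, max_eq_left hI0]
  have hM : (t : EReal) * (A : EReal) + ((1 - t : ℝ) : EReal) * (B : EReal) =
      ((t * A + (1 - t) * B : ℝ) : EReal) := by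
    rw [EReal.coe_add, EReal.coe_mul, EReal.coe_mul]
  have hS : (C : EReal) - ((t * A + (1 - t) * B : ℝ) : EReal) =
      ((C - (t * A + (1 - t) * B) : ℝ) : EReal) := (EReal.coe_sub _ _).symm
  rw [hI', hA, hB, hC, hD, hM, hS, ← EReal.coe_add, EReal.coe_nonneg, EReal.coe_le_coe_iff,
    EReal.coe_eq_zero]
  simp only [EReal.coe_eq_coe_iff]
  refine ⟨by simp [hI], by ring, by linarith, by linarith, ?_, ?_, ?_, ?_⟩
  -- After cancelling h(X) + h(Y), equality in the reverse inequality is equality in the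
  -- entropy-power inequality for V; the same holds for the upper bound on the deficit.
  · rw [← hVeq]
    constructor <;> intro h <;> linarith
  · rw [← hUeq]
    constructor <;> intro h <;> linarith
  · rw [← hVeq]
    constructor <;> intro h <;> linarith
  -- The mutual information is the sum of the deficits of U and V, both nonnegative, so it vanishes
  -- exactly when both do.
  · rw [hI, ENNReal.ofReal_eq_zero]
    constructor
    · intro h
      exact hUeq.1 (by linarith)
    · intro h
      linarith [hUeq.2 h, hVeq.2 h]
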